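/- **Task systems.** A task system $\Upsilon$ consists of $n$ preemptible tasks, partitioned into hard and soft tasks and scheduled on one processor in discrete time. Task $i$ is given by a finitely supported probability distribution $\mathcal C_i$ of computation times (positive integers), a relative deadline $D_i\in\mathbb N$, and a finitely supported distribution $\mathcal A_i$ of inter-arrival times (natural numbers), with $\max \mathrm{Supp}(\mathcal C_i)\le D_i\le \min \mathrm{Supp}(\mathcal A_i)$; the domain of each distribution is its support. All tasks submit a job at time $0$; all computation times and inter-arrival times are independent. In each tick the scheduler runs one active job (unfinished, deadline not yet passed) or idles, and then sees, for each task, whether its current job is complete and whether a new job arrives (an unfinished old job is then discarded). This is modelled by a Markov decision process $\Gamma_\Upsilon$ whose vertices record, for every task, the distribution of the remaining computation time, the time to the deadline, and the distribution of the time to the next arrival. The structure of $\Upsilon$ is the set of hard tasks together with all $D_i$, $\mathrm{Supp}(\mathcal C_i)$ and $\mathrm{Supp}(\mathcal A_i)$. Write $\Upsilon\approx^{\epsilon}\Upsilon'$ if both have the same structure and the probabilities given by corresponding distributions differ by at most $\epsilon$ at every point. A scheduler choice (edge) in a vertex $v$ is safe if some memoryless deterministic strategy makes that choice in $v$ and guarantees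 from $v$ that no hard job ever misses its deadline. $\Upsilon$ is schedulable for its hard tasks if such a strategy exists from the initial vertex. The safe region $\Gamma^{\mathrm{safe}}_\Upsilon$ is the part of $\Gamma_\Upsilon$ reachable from the initial vertex through safe edges. It is *good for sampling* if for every soft task $i$ it has a vertex $v_i$ in which a new job of task $i$ enters the system, and a memoryless deterministic strategy $\sigma_i$ using only safe edges under which, from $v_i$, this job is guaranteed to be completed by its deadline. **Theorem.** There is a (randomised, computable) learning algorithm such that the following holds for every task system $\Upsilon$ that is schedulable for its hard tasks and whose safe region is good for sampling, and for all rational $\epsilon,\gamma\in(0,1)$. Given only $\epsilon$, $\gamma$ and the structure of $\Upsilon$, and observing only the execution of $\Upsilon$ that it controls, the algorithm ensures that no job of a hard task ever misses its deadline, it outputs a model with probability one, and with probability at least $1-\gamma$ the model $\Upsilon^M$ that it outputs satisfies $\Upsilon^M\approx^{\epsilon}\Upsilon$. That is, the class of these task systems is safely PAC learnable. -/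

import Mathlib

namespace TaskLearning

/-- A preemptible task: law `comp` of the computation time of a job, relative `deadline`, and law
`arr` of the time between two successive arrivals.  Both laws are finite discrete distributions;
the domain of a distribution is the set of its possible values, that is, its support. -/
structure Task where
  comp : PMF ℕ
  deadline : ℕ
  arr : PMF ℕ
  comp_finite : comp.support.Finite
  arr_finite : arr.support.Finite
  comp_pos : ∀ c ∈ comp.support, 0 < c
  comp_le : ∀ c ∈ comp.support, c ≤ deadline
  le_arr : ∀ a ∈ arr.support, deadline ≤ a

/-- A system of `n` tasks; those in `hard` are hard, all the others are soft. -/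
structure TaskSystem (n : ℕ) where
  task : Fin n → Task
  hard : Finset (Fin n)

/-- `p ∼^ε q`. -/
def CloseDist (ε : ℝ) (p q : PMF ℕ) : Prop :=
  p.support = q.support ∧ ∀ a ∈ p.support, |(p a).toReal - (q a).toReal| ≤ ε

/-- `Υ₁ ≈^ε Υ₂`: same structure (hard tasks, deadlines, domains), and `ε`-close distributions. -/
def TaskSystem.Close {n : ℕ} (ε : ℝ) (Υ₁ Υ₂ : TaskSystem n) : Prop :=
  Υ₁.hard = Υ₂.hard ∧ ∀ i,
    (Υ₁.task i).comp.support = (Υ₂.task i).comp.support ∧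
    (Υ₁.task i).deadline = (Υ₂.task i).deadline ∧
    (Υ₁.task i).arr.support = (Υ₂.task i).arr.support ∧
    CloseDist ε (Υ₁.task i).arr (Υ₂.task i).arr ∧
    CloseDist ε (Υ₁.task i).comp (Υ₂.task i).comp

/-! ### The Markov decision model of a task system -/

/-- The component of a vertex that belongs to one task: law `c` of the remaining computation time
of the current job, time `d` up to its deadline, law `a` of the time up to the next arrival. -/
structure JobState where
  c : PMF ℕ
  d : ℕ
  a : PMF ℕ

/-- Vertices (of the scheduler as well as of the task generator) are vectors of job states. -/
abbrev Config (n : ℕ) := Fin n → JobState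

/-- What the generator does with one task in one tick: the first component tells whether the
current job of the task is complete, the second whether a new job is submitted.  Thus
`(true, true)` is `sub`, `(false, true)` is `killANDsub`, `(false, false)` is `ε`, and
`(true, false)` is `fin` (or `ε`, if the job was complete before). -/
abbrev Moves (n : ℕ) := Fin n → Bool × Bool

/-- One time unit elapses: all values are decremented. -/
noncomputable def dec (p : PMF ℕ) : PMF ℕ := p.map fun k => k - 1

open Classical in
/-- The distribution `p` conditioned on the value not being `0`. -/
noncomputable def renorm (p : PMF ℕ) : PMF ℕ :=
  if h : ∃ k ∈ ({0}ᶜ : Set ℕ), k ∈ p.support then p.filter {0}ᶜ h else p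

/-- Task `i` has an active job: not complete, and its deadline has not passed. -/
def Active {n : ℕ} (s : Config n) (i : Fin n) : Prop := (s i).c 0 ≠ 1 ∧ 0 < (s i).d

/-- The scheduler may run an active task, or idle (`none`). -/
def Allowed {n : ℕ} (s : Config n) (act : Option (Fin n)) : Prop := ∀ i, act = some i → Active s i

/-- The generator vertex reached from the scheduler vertex `s` by the action `act`. -/
noncomputable def tick {n : ℕ} (s : Config n) (act : Option (Fin n)) : Config n := fun i =>
  { c := if act = some i then dec (s i).c else (s i).c
    d := (s i).d - 1
    a := dec (s i).a }

/-- Law of the move of the generator for one task: the job is complete with probability `c(0)`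
and, independently, a new job is submitted with probability `a(0)`. -/
noncomputable def jobMove (x : JobState) : PMF (Bool × Bool) :=
  x.c.bind fun k => x.a.map fun l => (decide (k = 0), decide (l = 0))

/-- Law of the move of the generator in its vertex `s`: the tasks are independent. -/
noncomputable def genMove {n : ℕ} (s : Config n) : PMF (Moves n) :=
  PMF.ofFintype (fun m => ∏ i, jobMove (s i) (m i)) <| by
    have h : ∀ i, ∑ b, jobMove (s i) b = 1 := fun i => by
      rw [← tsum_fintype (L := .unconditional _)]
      exact (jobMove (s i)).tsum_coe
    rw [← Fintype.prod_sum]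
    simp [h]

namespace TaskSystem

variable {n : ℕ} (Υ : TaskSystem n)

/-- State of task `i` when a new job has just been submitted. -/
def fresh (i : Fin n) : JobState := ⟨(Υ.task i).comp, (Υ.task i).deadline, (Υ.task i).arr⟩

/-- The initial vertex: all tasks submit a job at time `0`. -/
def init : Config n := Υ.fresh

/-- The scheduler vertex reached from the generator vertex `s` by the move `m`. -/
noncomputable def resolve (s : Config n) (m : Moves n) : Config n := fun i =>
  if (m i).2 then Υ.fresh i
  else { c := if (m i).1 then PMF.pure 0 else renorm (s i).c
         d := (s i).d
         a := renorm (s i).a }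

/-- In the generator vertex `s`, the move `m` reveals that a hard task has missed a deadline:
its deadline is reached and its job is not complete.  These are the moves that lead to the bad
vertex. -/
def HardMiss (s : Config n) (m : Moves n) : Prop :=
  ∃ i ∈ Υ.hard, (s i).d = 0 ∧ (m i).1 = false

/-- A (memoryless deterministic) strategy of the scheduler. -/
def IsStrategy (σ : Config n → Option (Fin n)) : Prop := ∀ s, Allowed s (σ s)

/-- The scheduler vertices `s k` and the generator moves `m k` form a play in which the
scheduler follows `σ`. -/
def IsPlay (σ : Config n → Option (Fin n)) (s : ℕ → Config n) (m : ℕ → Moves n) : Prop :=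
  ∀ k, m k ∈ (genMove (tick (s k) (σ (s k)))).support ∧
    s (k + 1) = Υ.resolve (tick (s k) (σ (s k))) (m k)

/-- `σ` is a safe strategy from the vertex `s₀`. -/
def SafeFrom (σ : Config n → Option (Fin n)) (s₀ : Config n) : Prop :=
  IsStrategy σ ∧ ∀ s m, Υ.IsPlay σ s m → s 0 = s₀ →
    ∀ k, ¬ Υ.HardMiss (tick (s k) (σ (s k))) (m k)

/-- The system is schedulable for its hard tasks. -/
def Schedulable : Prop := ∃ σ, Υ.SafeFrom σ Υ.init

/-- The edge labelled `act` from `s` is safe. -/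
def SafeEdge (s : Config n) (act : Option (Fin n)) : Prop := ∃ σ, Υ.SafeFrom σ s ∧ σ s = act

/-- The scheduler vertices of the safe region: those reachable through safe edges. -/
inductive InSafeRegion : Config n → Prop
  | init : InSafeRegion Υ.init
  | step (s : Config n) (act : Option (Fin n)) (m : Moves n) : InSafeRegion s →
      Υ.SafeEdge s act → m ∈ (genMove (tick s act)).support →
      InSafeRegion (Υ.resolve (tick s act) m)

/-- The safe region is good for sampling: for every soft task `i` it has a vertex `v` in which a
new job of `i` enters the system, and a strategy `σ` that uses only safe edges and under which,
from `v`, the new job is complete within its `deadline` many ticks along every play. -/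
def GoodForSampling : Prop :=
  ∀ i ∉ Υ.hard, ∃ v, Υ.InSafeRegion v ∧ v i = Υ.fresh i ∧
    ∃ σ, IsStrategy σ ∧ (∀ s, Υ.InSafeRegion s → Υ.SafeEdge s (σ s)) ∧
      ∀ s m, Υ.IsPlay σ s m → s 0 = v → ∃ k < (Υ.task i).deadline, (m k i).1 = true

end TaskSystem

/-! ### Learning algorithms -/

/-- Finite description of the structure of a task system: for each task, whether it is hard, the
computation times, the deadline, and the inter-arrival times. -/
abbrev StructCode := List (Bool × List ℕ × ℕ × List ℕ)

/-- Finite description of a distribution on `ℕ` with rational probabilities: a list of pairs of a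
value and a weight; probabilities are proportional to weights. -/
abbrev DistCode := List (ℕ × ℕ)

/-- Finite description of a task system with rational probabilities. -/
abbrev ModelCode := List (Bool × DistCode × ℕ × DistCode)

/-- What the learner has seen of the execution, most recent tick first: for each tick, the task
that was run and the move of the generator for each task. -/
abbrev Observation := List (Option ℕ × List (Bool × Bool))

/-- What a learner is given: the structure of the system, `ε` and `γ` as fractions, and the
observations made so far. -/
abbrev LearnerInput := (StructCode × (ℕ × ℕ) × (ℕ × ℕ)) × Observation

/-- A randomised learner: in each tick it returns the list of actions from which the next one is
drawn uniformly at random, and possibly a learnt model. -/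
abbrev Learner := LearnerInput → List (Option ℕ) × Option ModelCode

noncomputable def TaskSystem.structCode {n : ℕ} (Υ : TaskSystem n) : StructCode :=
  List.ofFn fun i =>
    (decide (i ∈ Υ.hard), (Υ.task i).comp_finite.toFinset.sort (· ≤ ·), (Υ.task i).deadline,
      (Υ.task i).arr_finite.toFinset.sort (· ≤ ·))

/-- `l` describes the distribution `p`. -/
def DistCode.Describes (l : DistCode) (p : PMF ℕ) : Prop :=
  ∀ a, p a = (((l.filter fun x => x.1 = a).map Prod.snd).sum : ENNReal) /
    ((l.map Prod.snd).sum : ENNReal)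

/-- `l` describes the task system `Υ`. -/
def ModelCode.Describes {n : ℕ} (l : ModelCode) (Υ : TaskSystem n) : Prop :=
  ∃ f : Fin n → Bool × DistCode × ℕ × DistCode, l = List.ofFn f ∧
    ∀ i, (f i).1 = decide (i ∈ Υ.hard) ∧ DistCode.Describes (f i).2.1 (Υ.task i).comp ∧
      (f i).2.2.1 = (Υ.task i).deadline ∧ DistCode.Describes (f i).2.2.2 (Υ.task i).arr

/-- Finite executions of a system of `n` tasks, most recent tick first. -/
abbrev History (n : ℕ) := List (Option (Fin n) × Moves n)

def History.observation {n : ℕ} (h : History n) : Observation :=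
  h.map fun x => (x.1.map Fin.val, List.ofFn x.2)

open Classical in
/-- The action carried out in `s` when the learner asks for `r`; asking for a task without an
active job means idling. -/
noncomputable def effective {n : ℕ} (s : Config n) (r : Option ℕ) : Option (Fin n) :=
  r.bind fun k => if h : k < n then (if Active s ⟨k, h⟩ then some ⟨k, h⟩ else none) else none

/-- Uniform choice from the entries of a list (`none` if the list is empty). -/
noncomputable def drawFrom (l : List (Option ℕ)) : PMF (Option ℕ) :=
  if h : (l : Multiset (Option ℕ)) = 0 then PMF.pure none else PMF.ofMultiset l h

namespace TaskSystem

variable {n : ℕ} (Υ : TaskSystem n)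

/-- The scheduler vertex at the end of a finite execution. -/
noncomputable def configAt : History n → Config n
  | [] => Υ.init
  | x :: h => Υ.resolve (tick (configAt h) x.1) x.2

/-- A hard task has missed a deadline during the execution. -/
def Missed : History n → Prop
  | [] => False
  | x :: h => Υ.HardMiss (tick (Υ.configAt h) x.1) x.2 ∨ Missed h

/-- The reply of the learner after the execution `h`. -/
noncomputable def reply (L : Learner) (ε γ : ℚ) (h : History n) :
    List (Option ℕ) × Option ModelCode :=
  L ((Υ.structCode, (ε.num.toNat, ε.den), (γ.num.toNat, γ.den)), h.observation)

/-- Law of the first `t` ticks of the execution of the system under the control of the learner. -/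
noncomputable def run (L : Learner) (ε γ : ℚ) : ℕ → PMF (History n)
  | 0 => PMF.pure []
  | t + 1 => (run L ε γ t).bind fun h =>
      (drawFrom (Υ.reply L ε γ h).1).bind fun r =>
        let act := effective (Υ.configAt h) r
        (genMove (tick (Υ.configAt h) act)).map fun m => (act, m) :: h

/-- The output of the learner: the first model that it returns during the execution, if any. -/
noncomputable def output (L : Learner) (ε γ : ℚ) : History n → Option ModelCode
  | [] => (Υ.reply L ε γ []).2
  | x :: h => (output L ε γ h).or (Υ.reply L ε γ (x :: h)).2

/-- No hard task misses a deadline in any possible execution under the control of the learner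
(neither before nor after the output). -/
def KeepsSafe (L : Learner) (ε γ : ℚ) : Prop :=
  ∀ t, ∀ h ∈ (Υ.run L ε γ t).support, ¬ Υ.Missed h

/-- The probability that the learner outputs, at some time, a model with property `P`.  (An output
is never revoked, so this is the limit of the increasing probabilities at time `t`.) -/
noncomputable def probOutput (L : Learner) (ε γ : ℚ) (P : ModelCode → Prop) : ENNReal :=
  ⨆ t, (Υ.run L ε γ t).toOuterMeasure {h | ∃ M, Υ.output L ε γ h = some M ∧ P M}

end TaskSystem

/-- A class of task systems is safely PAC learnable: there is one algorithm which, for every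
system `Υ` of the class and all `ε, γ ∈ (0, 1)`, given the structure of `Υ`, executes `Υ`
while keeping the hard tasks safe, outputs a model with probability one, and with probability at
least `1 - γ` outputs a model that is `ε`-close to `Υ`. -/
def SafelyPACLearnable (𝒞 : ∀ n, Set (TaskSystem n)) : Prop :=
  ∃ L : Learner, Computable L ∧
    ∀ (n : ℕ) (Υ : TaskSystem n), Υ ∈ 𝒞 n →
      ∀ ε γ : ℚ, 0 < ε → ε < 1 → 0 < γ → γ < 1 →
        Υ.KeepsSafe L ε γ ∧
        Υ.probOutput L ε γ (fun _ => True) = 1 ∧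
        ENNReal.ofReal (1 - (γ : ℝ)) ≤ Υ.probOutput L ε γ
          (fun M => ∃ ΥM : TaskSystem n, ModelCode.Describes M ΥM ∧ ΥM.Close (ε : ℝ) Υ)

end TaskLearning

/-!
The learner runs the system forever and in each tick draws uniformly from the safe actions.

*Safety.* For each task, the ticks received by the current job, the time since its arrival, and
whether it is complete (its phase) determine the vertex of the decision process, whose laws are
residual laws of the given ones (`resolve_conc`), and the supports of these laws depend on the
structure only.  So the learner can play the safety game on the finitely many vectors of phases:
it removes vertices without a good action until nothing changes (`refine_safeSet`).  All safe
edges of the decision process survive (`SafeEdge.good`), and good actions never lead out of the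
remaining set.  All functions involved are primitive recursive, which `fun_prop` checks.

*Sampling.* A soft job may be discarded before it is complete, so that recording the computation
times of completed jobs would be biased.  Instead a sampler builds each sample by levels: if the
sample under construction is known to exceed `v`, the sampler waits for any job of the task that
has received exactly `v` ticks and is run again, and observes whether it completes; this event has
the conditional probability that a computation time exceeding `v` is equal to `v + 1`, whatever the
scheduler has done before.  Inter-arrival times are sampled in the same way.  The learner
outputs the empirical laws once every sampler has `N` samples; each possible value is counted once
more, to get the support right.

*Termination.* The memory of the learner is a Markov chain on a finite set.  The initial vertex can
be reached from everywhere (`Reach.exists_path_start`), from there the vertices of the safe region,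
and there a suitable strategy for task `i` makes the sampler of `i` progress
(`Reach.exists_progress`).  Hence a memory with full samplers can always be reached, and a minimum
principle shows that it is reached with probability one (`iSup_probFull`).

*Accuracy.* For every value `a`, the number of samples equal to `a`, corrected by the conditional
probability of `a` for the unfinished sample, minus its mean, is a martingale with increments
bounded by `1` per observation (`deviation_sq_step`).  A sampler uses a bounded number of
observations, so that the expected sum of the squared deviations is of order `N`
(`expect_run_totalPotential_le`), and Markov's inequality bounds the probability that some deviation
exceeds `ε / 2 * N` when all samplers are full (`toOuterMeasure_not_accurate_le`).
-/

namespace TaskLearning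

open scoped ENNReal

/-! ### Primitive recursion as a `fun_prop` class -/

section PrimrecRules

variable {α β σ : Type*} [Primcodable α] [Primcodable β] [Primcodable σ]

attribute [fun_prop] Primrec

@[fun_prop]
theorem primrec_const (b : β) : Primrec (fun _ : α => b) := Primrec.const b

@[fun_prop]
theorem primrec_comp {f : β → σ} {g : α → β} (hf : Primrec f) (hg : Primrec g) :
    Primrec (fun x => f (g x)) := hf.comp hg

@[fun_prop]
theorem primrec_fst : Primrec (fun x : α × β => x.1) := Primrec.fst

@[fun_prop]
theorem primrec_snd : Primrec (fun x : α × β => x.2) := Primrec.snd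

@[fun_prop]
theorem primrec_pair {f : α → β} {g : α → σ} (hf : Primrec f) (hg : Primrec g) :
    Primrec (fun x => (f x, g x)) := hf.pair hg

@[fun_prop]
theorem primrec_some {f : α → β} (hf : Primrec f) : Primrec (fun x => some (f x)) :=
  Primrec.option_some.comp hf

@[fun_prop]
theorem primrec_add {f g : α → ℕ} (hf : Primrec f) (hg : Primrec g) :
    Primrec (fun x => f x + g x) := Primrec.nat_add.comp hf hg

@[fun_prop]
theorem primrec_mul {f g : α → ℕ} (hf : Primrec f) (hg : Primrec g) :
    Primrec (fun x => f x * g x) := Primrec.nat_mul.comp hf hg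

@[fun_prop]
theorem primrec_and {f g : α → Bool} (hf : Primrec f) (hg : Primrec g) :
    Primrec (fun x => f x && g x) := Primrec.and.comp hf hg

@[fun_prop]
theorem primrec_or {f g : α → Bool} (hf : Primrec f) (hg : Primrec g) :
    Primrec (fun x => f x || g x) := Primrec.or.comp hf hg

@[fun_prop]
theorem primrec_not {f : α → Bool} (hf : Primrec f) : Primrec (fun x => !f x) :=
  Primrec.not.comp hf

@[fun_prop]
theorem primrec_decide_le {f g : α → ℕ} (hf : Primrec f) (hg : Primrec g) :
    Primrec (fun x => decide (f x ≤ g x)) :=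
  (Primrec.nat_le.comp hf hg).decide

@[fun_prop]
theorem primrec_decide_lt {f g : α → ℕ} (hf : Primrec f) (hg : Primrec g) :
    Primrec (fun x => decide (f x < g x)) :=
  (Primrec.nat_lt.comp hf hg).decide

@[fun_prop]
theorem primrec_decide_eq [DecidableEq β] {f g : α → β} (hf : Primrec f) (hg : Primrec g) :
    Primrec (fun x => decide (f x = g x)) :=
  (Primrec.eq.comp hf hg).decide

@[fun_prop]
theorem primrec_ite {c : α → Bool} {f g : α → β} (hc : Primrec c) (hf : Primrec f)
    (hg : Primrec g) : Primrec (fun x => if c x then f x else g x) :=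
  (Primrec.cond hc hf hg).of_eq fun x => by cases c x <;> rfl

@[fun_prop]
theorem primrec_cons {f : α → β} {g : α → List β} (hf : Primrec f) (hg : Primrec g) :
    Primrec (fun x => f x :: g x) := Primrec.list_cons.comp hf hg

@[fun_prop]
theorem primrec_append {f g : α → List β} (hf : Primrec f) (hg : Primrec g) :
    Primrec (fun x => f x ++ g x) := Primrec.list_append.comp hf hg

@[fun_prop]
theorem primrec_length {f : α → List β} (hf : Primrec f) : Primrec (fun x => (f x).length) :=
  Primrec.list_length.comp hf

@[fun_prop]
theorem primrec_range {f : α → ℕ} (hf : Primrec f) : Primrec (fun x => List.range (f x)) :=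
  Primrec.list_range.comp hf

@[fun_prop]
theorem primrec_getD (d : β) {f : α → List β} {g : α → ℕ} (hf : Primrec f) (hg : Primrec g) :
    Primrec (fun x => (f x).getD (g x) d) := (Primrec.list_getD d).comp hf hg

@[fun_prop]
theorem primrec_map {f : α → List β} {g : α → β → σ} (hf : Primrec f)
    (hg : Primrec (fun p : α × β => g p.1 p.2)) : Primrec (fun x => (f x).map (g x)) :=
  Primrec.list_map hf hg

@[fun_prop]
theorem primrec_flatMap {f : α → List β} {g : α → β → List σ} (hf : Primrec f)
    (hg : Primrec (fun p : α × β => g p.1 p.2)) : Primrec (fun x => (f x).flatMap (g x)) :=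
  Primrec.list_flatMap hf hg

@[fun_prop]
theorem primrec_foldr {f : α → List β} {g : α → σ} {h : α → β → σ → σ} (hf : Primrec f)
    (hg : Primrec g) (hh : Primrec (fun p : α × β × σ => h p.1 p.2.1 p.2.2)) :
    Primrec (fun x => (f x).foldr (h x) (g x)) :=
  Primrec.list_foldr (h := fun x p => h x p.1 p.2) hf hg hh

@[fun_prop]
theorem primrec_all {f : α → List β} {g : α → β → Bool} (hf : Primrec f)
    (hg : Primrec (fun p : α × β => g p.1 p.2)) : Primrec (fun x => (f x).all (g x)) := by
  have : Primrec (fun x => (f x).foldr (fun b r => g x b && r) true) :=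
    primrec_foldr hf (by fun_prop)
      (primrec_and (primrec_comp (g := fun p : α × β × Bool => (p.1, p.2.1)) hg (by fun_prop))
        (by fun_prop))
  refine this.of_eq fun x => ?_
  induction f x with
  | nil => rfl
  | cons b l ih => simp [ih]

@[fun_prop]
theorem primrec_any {f : α → List β} {g : α → β → Bool} (hf : Primrec f)
    (hg : Primrec (fun p : α × β => g p.1 p.2)) : Primrec (fun x => (f x).any (g x)) := by
  have : Primrec (fun x => !(f x).all (fun b => !g x b)) := by fun_prop
  exact this.of_eq fun x => by simp [List.all_eq_not_any_not]

@[fun_prop]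
theorem primrec_filter {f : α → List β} {g : α → β → Bool} (hf : Primrec f)
    (hg : Primrec (fun p : α × β => g p.1 p.2)) : Primrec (fun x => (f x).filter (g x)) := by
  have : Primrec (fun x => (f x).flatMap (fun b => if g x b then [b] else [])) :=
    primrec_flatMap hf (primrec_ite hg (by fun_prop) (by fun_prop))
  refine this.of_eq fun x => ?_
  induction f x with
  | nil => rfl
  | cons b l ih => rw [List.flatMap_cons, ih, List.filter_cons]; cases g x b <;> rfl

@[fun_prop]
theorem primrec_iterate {f : α → ℕ} {g : α → β} {h : α → β → β} (hf : Primrec f)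
    (hg : Primrec g) (hh : Primrec (fun p : α × β => h p.1 p.2)) :
    Primrec (fun x => (h x)^[f x] (g x)) :=
  Primrec.nat_iterate hf hg hh

end PrimrecRules

/-! ### The algorithm -/

/-- What the algorithm knows about one task in advance: whether it is hard, its computation
times, its deadline, and its inter-arrival times. -/
abbrev Entry := Bool × List ℕ × ℕ × List ℕ

/-- The observable state of one task: ticks received by the current job, time since its arrival,
and whether it is complete. -/
abbrev Phase := ℕ × ℕ × Bool

/-- A sampler for a law `p` on the positive integers: the current level `v`, meaning that the
sample under construction is known to be greater than `v`, and the finished samples. -/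
abbrev Sampler := ℕ × List ℕ

namespace Algo

/-- The task has an active job. -/
def active (t : Entry) (x : Phase) : Bool := !x.2.2 && decide (x.2.1 < t.2.2.1)

/-- The moves of the generator for one task that have positive probability after a tick; `run`
tells whether the task was run. -/
def possible (t : Entry) (x : Phase) (run : Bool) (m : Bool × Bool) : Bool :=
  (if x.2.2 then m.1 else if run then
    (if m.1 then t.2.1.any (fun c => decide (c = x.1 + 1))
      else t.2.1.any (fun c => decide (x.1 + 1 < c))) else !m.1) &&
  (if m.2 then t.2.2.2.any (fun a => decide (a = x.2.1 + 1))
    else t.2.2.2.any (fun a => decide (x.2.1 + 1 < a)))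

/-- The state of a task after a tick and a move of the generator. -/
def next (x : Phase) (run : Bool) (m : Bool × Bool) : Phase :=
  if m.2 then (0, 0, false) else (if run then x.1 + 1 else x.1, x.2.1 + 1, m.1)

/-- The move reveals that the job of a hard task is incomplete at its deadline. -/
def miss (t : Entry) (x : Phase) (m : Bool × Bool) : Bool :=
  t.1 && decide (t.2.2.1 ≤ x.2.1 + 1) && !m.1

/-- One step of a sampler at level `v`: if the observed object has reached level `v`, the event
`success` tells whether its value is `v + 1`.  A sampler with `N` samples is full and stays as it
is. -/
def sample (N : ℕ) (run : Bool) (level : ℕ) (success : Bool) (q : Sampler) : Sampler :=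
  if run && decide (level = q.1) && decide (q.2.length < N) then
    (if success then (0, (q.1 + 1) :: q.2) else (q.1 + 1, q.2))
  else q

/-- What the algorithm stores for one task: the phase of the task, and samplers for its
computation time and its inter-arrival time. -/
abbrev Memo := Phase × Sampler × Sampler

/-- Update of the memory for one task after a tick. -/
def update (N : ℕ) (y : Memo) (run : Bool) (m : Bool × Bool) : Memo :=
  (next y.1 run m, sample N run y.1.1 m.1 y.2.1, sample N true y.1.2.1 m.2 y.2.2)

/-- Memory for a task at the beginning. -/
def start : Memo := ((0, 0, false), (0, []), (0, []))

/-- The lists that choose one element from each of the given lists. -/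
def choices {α : Type*} (l : List (List α)) : List (List α) :=
  l.foldr (fun a r => a.flatMap fun x => r.map fun y => x :: y) [[]]

/-- The possible moves for one task. -/
def movesOne (t : Entry) (x : Phase) (run : Bool) : List (Bool × Bool) :=
  [(false, false), (false, true), (true, false), (true, true)].filter (possible t x run)

/-- The possible moves of the generator after the action `act`. -/
def moves (s : StructCode) (xs : List Phase) (act : Option ℕ) : List (List (Bool × Bool)) :=
  choices <| (List.range s.length).map fun i =>
    movesOne (s.getD i default) (xs.getD i default) (decide (act = some i))

/-- The phases of all tasks after the action `act` and the move `ms`. -/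
def nextAll (xs : List Phase) (act : Option ℕ) (ms : List (Bool × Bool)) : List Phase :=
  (List.range xs.length).map fun i =>
    next (xs.getD i default) (decide (act = some i)) (ms.getD i default)

/-- The action `act` is allowed, and whatever the generator does, no hard task misses its
deadline and the next vertex belongs to `W`. -/
def good (s : StructCode) (W : List (List Phase)) (xs : List Phase) (act : Option ℕ) : Bool :=
  ((List.range s.length).all fun i =>
    !decide (act = some i) || active (s.getD i default) (xs.getD i default)) &&
  (moves s xs act).all fun ms =>
    ((List.range s.length).all fun i =>
      !miss (s.getD i default) (xs.getD i default) (ms.getD i default)) &&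
    W.any fun ys => decide (ys = nextAll xs act ms)

/-- The actions that are good with respect to `W`. -/
def actions (s : StructCode) (W : List (List Phase)) (xs : List Phase) : List (Option ℕ) :=
  (none :: (List.range s.length).map some).filter (good s W xs)

/-- A bound for all numbers that occur in a structure. -/
def bound (s : StructCode) : ℕ :=
  s.foldr (fun t r => t.2.1.foldr (· + ·) 0 + t.2.2.2.foldr (· + ·) 0 + r) 1

/-- All vectors of phases with entries below the bound. -/
def vertices (s : StructCode) : List (List Phase) :=
  choices <| s.map fun _ => (List.range (bound s)).flatMap fun e =>
    (List.range (bound s)).flatMap fun b => [(e, b, true), (e, b, false)]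

/-- Removal of the vertices without a good action. -/
def refine (s : StructCode) (W : List (List Phase)) : List (List Phase) :=
  W.filter fun xs => decide (0 < (actions s W xs).length)

/-- The vertices from which the hard tasks can be kept safe. -/
def safeSet (s : StructCode) : List (List Phase) := (refine s)^[(vertices s).length] (vertices s)

/-- The number of samples collected for each law, where `ε.2` and `γ.2` are the denominators of the
accuracy and of the confidence parameter.  If `K` bounds all numbers in the structure, the expected
sum of the squared deviations of `n` tasks is at most `2 * n * K ^ 2 * N`, which has to be small
compared with `γ * (ε / 2 * N) ^ 2`. -/
def sampleSize (s : StructCode) (ε γ : ℕ × ℕ) : ℕ :=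
  8 * ((s.length + 1) * (bound s * bound s) * (ε.2 * ε.2) * γ.2)

/-- The memory of the algorithm after some observations. -/
def memory (N n : ℕ) (o : Observation) : List Memo :=
  o.foldr (fun x st => (List.range n).map fun i =>
    update N (st.getD i start) (decide (x.1 = some i)) (x.2.getD i default))
    ((List.range n).map fun _ => start)

/-- All samplers are full. -/
def full (N : ℕ) (st : List Memo) : Bool :=
  st.all fun y => decide (N ≤ y.2.1.2.length) && decide (N ≤ y.2.2.2.length)

/-- The learnt model: empirical laws, where each possible value is counted once more. -/
def model (s : StructCode) (st : List Memo) : ModelCode :=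
  (List.range s.length).map fun i =>
    ((s.getD i default).1,
      ((s.getD i default).2.1 ++ (st.getD i start).2.1.2).map (fun a => (a, 1)),
      (s.getD i default).2.2.1,
      ((s.getD i default).2.2.2 ++ (st.getD i start).2.2.2).map (fun a => (a, 1)))

/-- The reply in a given state of the memory. -/
def answer (s : StructCode) (N : ℕ) (st : List Memo) : List (Option ℕ) × Option ModelCode :=
  (actions s (safeSet s) (st.map fun y => y.1), if full N st then some (model s st) else none)

/-- The learner: it draws uniformly from the safe actions and collects samples. -/
def learner : Learner := fun x =>
  answer x.1.1 (sampleSize x.1.1 x.1.2.1 x.1.2.2)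
    (memory (sampleSize x.1.1 x.1.2.1 x.1.2.2) x.1.1.length x.2)

section

variable {α : Type*} [Primcodable α]

@[fun_prop]
theorem primrec_active {f : α → Entry} {g : α → Phase} (hf : Primrec f) (hg : Primrec g) :
    Primrec (fun x => active (f x) (g x)) := by unfold active; fun_prop

@[fun_prop]
theorem primrec_possible {f : α → Entry} {g : α → Phase} {h : α → Bool} {k : α → Bool × Bool}
    (hf : Primrec f) (hg : Primrec g) (hh : Primrec h) (hk : Primrec k) :
    Primrec (fun x => possible (f x) (g x) (h x) (k x)) := by unfold possible; fun_prop

@[fun_prop]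
theorem primrec_next {g : α → Phase} {h : α → Bool} {k : α → Bool × Bool}
    (hg : Primrec g) (hh : Primrec h) (hk : Primrec k) :
    Primrec (fun x => next (g x) (h x) (k x)) := by unfold next; fun_prop

@[fun_prop]
theorem primrec_miss {f : α → Entry} {g : α → Phase} {k : α → Bool × Bool}
    (hf : Primrec f) (hg : Primrec g) (hk : Primrec k) :
    Primrec (fun x => miss (f x) (g x) (k x)) := by unfold miss; fun_prop

@[fun_prop]
theorem primrec_sample {f : α → ℕ} {g : α → Bool} {h : α → ℕ} {k : α → Bool} {q : α → Sampler}
    (hf : Primrec f) (hg : Primrec g) (hh : Primrec h) (hk : Primrec k) (hq : Primrec q) :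
    Primrec (fun x => sample (f x) (g x) (h x) (k x) (q x)) := by unfold sample; fun_prop

@[fun_prop]
theorem primrec_update {f : α → ℕ} {g : α → Memo} {h : α → Bool} {k : α → Bool × Bool}
    (hf : Primrec f) (hg : Primrec g) (hh : Primrec h) (hk : Primrec k) :
    Primrec (fun x => update (f x) (g x) (h x) (k x)) := by unfold update; fun_prop

@[fun_prop]
theorem primrec_choices {β : Type*} [Primcodable β] {f : α → List (List β)} (hf : Primrec f) :
    Primrec (fun x => choices (f x)) := by unfold choices; fun_prop

@[fun_prop]
theorem primrec_movesOne {f : α → Entry} {g : α → Phase} {h : α → Bool}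
    (hf : Primrec f) (hg : Primrec g) (hh : Primrec h) :
    Primrec (fun x => movesOne (f x) (g x) (h x)) := by unfold movesOne; fun_prop

@[fun_prop]
theorem primrec_moves {f : α → StructCode} {g : α → List Phase} {h : α → Option ℕ}
    (hf : Primrec f) (hg : Primrec g) (hh : Primrec h) :
    Primrec (fun x => moves (f x) (g x) (h x)) := by unfold moves; fun_prop

@[fun_prop]
theorem primrec_nextAll {g : α → List Phase} {h : α → Option ℕ} {k : α → List (Bool × Bool)}
    (hg : Primrec g) (hh : Primrec h) (hk : Primrec k) :
    Primrec (fun x => nextAll (g x) (h x) (k x)) := by unfold nextAll; fun_prop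

@[fun_prop]
theorem primrec_good {f : α → StructCode} {w : α → List (List Phase)} {g : α → List Phase}
    {h : α → Option ℕ} (hf : Primrec f) (hw : Primrec w) (hg : Primrec g) (hh : Primrec h) :
    Primrec (fun x => good (f x) (w x) (g x) (h x)) := by unfold good; fun_prop

@[fun_prop]
theorem primrec_actions {f : α → StructCode} {w : α → List (List Phase)} {g : α → List Phase}
    (hf : Primrec f) (hw : Primrec w) (hg : Primrec g) :
    Primrec (fun x => actions (f x) (w x) (g x)) := by unfold actions; fun_prop

@[fun_prop]
theorem primrec_bound {f : α → StructCode} (hf : Primrec f) :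
    Primrec (fun x => bound (f x)) := by unfold bound; fun_prop

@[fun_prop]
theorem primrec_vertices {f : α → StructCode} (hf : Primrec f) :
    Primrec (fun x => vertices (f x)) := by unfold vertices; fun_prop

@[fun_prop]
theorem primrec_refine {f : α → StructCode} {w : α → List (List Phase)} (hf : Primrec f)
    (hw : Primrec w) : Primrec (fun x => refine (f x) (w x)) := by unfold refine; fun_prop

@[fun_prop]
theorem primrec_safeSet {f : α → StructCode} (hf : Primrec f) :
    Primrec (fun x => safeSet (f x)) := by unfold safeSet; fun_prop

@[fun_prop]
theorem primrec_sampleSize {f : α → StructCode} {g h : α → ℕ × ℕ} (hf : Primrec f)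
    (hg : Primrec g) (hh : Primrec h) :
    Primrec (fun x => sampleSize (f x) (g x) (h x)) := by unfold sampleSize; fun_prop

@[fun_prop]
theorem primrec_memory {f g : α → ℕ} {h : α → Observation} (hf : Primrec f) (hg : Primrec g)
    (hh : Primrec h) : Primrec (fun x => memory (f x) (g x) (h x)) := by
  unfold memory; fun_prop

@[fun_prop]
theorem primrec_full {f : α → ℕ} {g : α → List Memo} (hf : Primrec f) (hg : Primrec g) :
    Primrec (fun x => full (f x) (g x)) := by unfold full; fun_prop

@[fun_prop]
theorem primrec_model {f : α → StructCode} {g : α → List Memo} (hf : Primrec f)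
    (hg : Primrec g) : Primrec (fun x => model (f x) (g x)) := by unfold model; fun_prop

@[fun_prop]
theorem primrec_answer {f : α → StructCode} {g : α → ℕ} {h : α → List Memo} (hf : Primrec f)
    (hg : Primrec g) (hh : Primrec h) : Primrec (fun x => answer (f x) (g x) (h x)) := by
  unfold answer; fun_prop

end

theorem computable_learner : Computable learner := by
  have : Primrec learner := by unfold learner; fun_prop
  exact this.to_comp

end Algo

/-! ### Residual laws and marginals of the generator -/

theorem renorm_eq_self {p : PMF ℕ} (h : p 0 = 0) : renorm p = p := by
  unfold renorm
  split_ifs with h'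
  · ext k
    have hs : ∑' k, (({0}ᶜ : Set ℕ).indicator p) k = 1 := by
      rw [← p.tsum_coe]
      refine tsum_congr fun k => ?_
      by_cases hk : k = 0
      · simp [hk, h]
      · simp [hk]
    rw [PMF.filter_apply, hs]
    by_cases hk : k = 0
    · simp [hk, h]
    · simp [hk]
  · rfl

theorem renorm_of_exists {p : PMF ℕ} (h : ∃ k ∈ p.support, k ≠ 0) :
    ∃ h', renorm p = p.filter {0}ᶜ h' := by
  obtain ⟨k, hk, h0⟩ := h
  have h' : ∃ k ∈ ({0}ᶜ : Set ℕ), k ∈ p.support := ⟨k, h0, hk⟩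
  exact ⟨h', by unfold renorm; rw [dif_pos h']⟩

theorem mem_support_renorm {p : PMF ℕ} (h : ∃ k ∈ p.support, k ≠ 0) {k : ℕ} :
    k ∈ (renorm p).support ↔ k ≠ 0 ∧ k ∈ p.support := by
  obtain ⟨h', e⟩ := renorm_of_exists h
  rw [e, PMF.mem_support_filter_iff]
  simp

theorem renorm_mul {p : PMF ℕ} (h : ∃ k ∈ p.support, k ≠ 0) {k : ℕ} (hk : k ≠ 0) :
    (renorm p k).toReal * (1 - (p 0).toReal) = (p k).toReal := by
  obtain ⟨h', e⟩ := renorm_of_exists h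
  have hs : p 0 + ∑' k, (({0}ᶜ : Set ℕ).indicator p) k = 1 := by
    have h1 := ENNReal.tsum_eq_add_tsum_ite (f := fun k => p k) 0
    rw [p.tsum_coe] at h1
    rw [h1]
    congr 1
    refine tsum_congr fun k => ?_
    by_cases hk : k = 0 <;> simp [hk]
  have hle : ∑' k, (({0}ᶜ : Set ℕ).indicator p) k ≠ ⊤ :=
    ne_top_of_le_ne_top ENNReal.one_ne_top (hs ▸ le_add_self)
  have hne : ∑' k, (({0}ᶜ : Set ℕ).indicator p) k ≠ 0 := by
    obtain ⟨j, hj, h0⟩ := h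
    intro h1
    have := ENNReal.tsum_eq_zero.1 h1 j
    rw [Set.indicator_of_mem (by simpa using h0)] at this
    exact hj this
  have hr : 1 - (p 0).toReal = (∑' k, (({0}ᶜ : Set ℕ).indicator p) k).toReal := by
    have := congrArg ENNReal.toReal hs
    rw [ENNReal.toReal_add (p.apply_ne_top 0) hle, ENNReal.toReal_one] at this
    linarith
  rw [e, PMF.filter_apply, hr, ← ENNReal.toReal_mul, mul_assoc, ENNReal.inv_mul_cancel hne hle,
    mul_one, Set.indicator_of_mem (by simpa using hk)]

theorem dec_apply_pos {p : PMF ℕ} {k : ℕ} (hk : 0 < k) : dec p k = p (k + 1) := by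
  unfold dec
  rw [PMF.map_apply, tsum_eq_single (k + 1)]
  · simp
  · intro j hj
    rw [if_neg]
    omega

theorem dec_apply_zero {p : PMF ℕ} (h : p 0 = 0) : dec p 0 = p 1 := by
  unfold dec
  rw [PMF.map_apply, tsum_eq_single 1]
  · simp
  · intro j hj
    rcases Nat.eq_zero_or_pos j with rfl | hj'
    · simp [h]
    · rw [if_neg]
      omega

theorem dec_apply {p : PMF ℕ} (h : p 0 = 0) (k : ℕ) : dec p k = p (k + 1) := by
  rcases Nat.eq_zero_or_pos k with rfl | hk
  · exact dec_apply_zero h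
  · exact dec_apply_pos hk

/-- For a law `p` on the positive integers, `resid p e` is the law of `X - e` given `e < X`, where
`X` has law `p`. -/
noncomputable def resid (p : PMF ℕ) : ℕ → PMF ℕ
  | 0 => p
  | e + 1 => renorm (dec (resid p e))

theorem mem_support_resid {p : PMF ℕ} (h0 : p 0 = 0) {e : ℕ} (he : ∃ c ∈ p.support, e < c)
    {k : ℕ} : k ∈ (resid p e).support ↔ 0 < k ∧ k + e ∈ p.support := by
  induction e generalizing k with
  | zero =>
    constructor
    · intro hk
      refine ⟨Nat.pos_of_ne_zero ?_, hk⟩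
      rintro rfl
      exact hk h0
    · exact fun hk => hk.2
  | succ e ih =>
    obtain ⟨c, hc, hec⟩ := he
    have ih' := fun {k} => ih ⟨c, hc, by omega⟩ (k := k)
    have h1 : resid p e 0 = 0 := by
      by_contra h
      exact absurd (ih'.1 h).1 (lt_irrefl 0)
    have h2 : ∀ k, k ∈ (dec (resid p e)).support ↔ k + 1 + e ∈ p.support := fun k => by
      rw [PMF.mem_support_iff, dec_apply h1, ← PMF.mem_support_iff, ih']
      simp
    rw [resid, mem_support_renorm ⟨c - (e + 1), ?_, by omega⟩, h2, Nat.pos_iff_ne_zero]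
    · rw [show k + 1 + e = k + (e + 1) by ring]
    · rw [h2]
      convert hc using 1
      omega

theorem resid_zero_right {p : PMF ℕ} (h0 : p 0 = 0) {e : ℕ} (he : ∃ c ∈ p.support, e < c) :
    resid p e 0 = 0 := by
  by_contra h
  exact absurd ((mem_support_resid h0 he).1 h).1 (lt_irrefl 0)

theorem mem_support_dec_resid {p : PMF ℕ} (h0 : p 0 = 0) {e : ℕ} (he : ∃ c ∈ p.support, e < c)
    {k : ℕ} : k ∈ (dec (resid p e)).support ↔ k + (e + 1) ∈ p.support := by
  rw [PMF.mem_support_iff, dec_apply (resid_zero_right h0 he), ← PMF.mem_support_iff,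
    mem_support_resid h0 he]
  simp [add_assoc, add_comm 1 e]

/-- The probability that a value is complete at level `e + 1`, given that it exceeds `e`, relates
the residual laws of successive levels. -/
theorem resid_succ_mul {p : PMF ℕ} (h0 : p 0 = 0) {e : ℕ} (he : ∃ c ∈ p.support, e + 1 < c)
    {k : ℕ} (hk : 0 < k) :
    (resid p (e + 1) k).toReal * (1 - (resid p e 1).toReal) = (resid p e (k + 1)).toReal := by
  obtain ⟨c, hc, hec⟩ := he
  have he' : ∃ c ∈ p.support, e < c := ⟨c, hc, by omega⟩
  have h1 := resid_zero_right h0 he'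
  rw [resid, ← dec_apply h1 k, ← dec_apply h1 0, renorm_mul _ hk.ne']
  refine ⟨c - (e + 1), (mem_support_dec_resid h0 he').2 ?_, by omega⟩
  convert hc using 1
  omega

theorem genMove_apply {n : ℕ} (s : Config n) (m : Moves n) :
    genMove s m = ∏ i, jobMove (s i) (m i) := rfl

theorem mem_support_genMove {n : ℕ} {s : Config n} {m : Moves n} :
    m ∈ (genMove s).support ↔ ∀ i, m i ∈ (jobMove (s i)).support := by
  simp [PMF.mem_support_iff, genMove_apply, Finset.prod_eq_zero_iff]

theorem mem_support_jobMove {x : JobState} {b : Bool × Bool} :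
    b ∈ (jobMove x).support ↔
      (∃ k ∈ x.c.support, b.1 = decide (k = 0)) ∧ ∃ l ∈ x.a.support, b.2 = decide (l = 0) := by
  unfold jobMove
  simp only [PMF.mem_support_bind_iff, PMF.mem_support_map_iff, Prod.ext_iff]
  constructor
  · rintro ⟨k, hk, l, hl, h1, h2⟩
    exact ⟨⟨k, hk, h1.symm⟩, l, hl, h2.symm⟩
  · rintro ⟨⟨k, hk, h1⟩, l, hl, h2⟩
    exact ⟨k, hk, l, hl, h1.symm, h2.symm⟩

theorem sum_genMove {n : ℕ} (s : Config n) (i : Fin n) (f : Bool × Bool → ℝ) :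
    ∑ m, (genMove s m).toReal * f (m i) = ∑ b, (jobMove (s i) b).toReal * f b := by
  classical
  let F : Fin n → Bool × Bool → ℝ := fun j b =>
    (jobMove (s j) b).toReal * if j = i then f b else 1
  have hF : ∀ m : Moves n, (genMove s m).toReal * f (m i) = ∏ j, F j (m j) := fun m => by
    simp only [F]
    rw [Finset.prod_mul_distrib, genMove_apply, ENNReal.toReal_prod, Finset.prod_ite_eq' _ i]
    simp
  have h1 : ∀ j, ∑ b, (jobMove (s j) b).toReal = 1 := fun j => by
    rw [← ENNReal.toReal_sum fun b _ => (jobMove (s j)).apply_ne_top b,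
      ← tsum_fintype (L := .unconditional _), (jobMove (s j)).tsum_coe, ENNReal.toReal_one]
  rw [Finset.sum_congr rfl fun m _ => hF m, ← Fintype.prod_sum, Finset.prod_eq_single i]
  · simp [F]
  · intro j _ hj
    simp [F, hj, h1]
  · simp

theorem sum_pmf_bool (p : PMF Bool) (f : Bool → ℝ) :
    ∑ b, (p b).toReal * f b = (p true).toReal * f true + (1 - (p true).toReal) * f false := by
  have h : (p true).toReal + (p false).toReal = 1 := by
    rw [← ENNReal.toReal_add (p.apply_ne_top _) (p.apply_ne_top _), ← Fintype.sum_bool,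
      ← tsum_fintype (L := .unconditional _), p.tsum_coe, ENNReal.toReal_one]
  rw [Fintype.sum_bool, ← h]
  ring

theorem sum_toReal_map {α β : Type*} [Fintype α] [Fintype β] (p : PMF α) (g : α → β)
    (f : β → ℝ) : ∑ a, (p a).toReal * f (g a) = ∑ b, (p.map g b).toReal * f b := by
  classical
  have : ∀ b, (p.map g b).toReal = ∑ a, if b = g a then (p a).toReal else 0 := fun b => by
    rw [PMF.map_apply, tsum_fintype, ENNReal.toReal_sum]
    · exact Finset.sum_congr rfl fun a _ => by split_ifs <;> simp
    · intro a _
      split_ifs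
      exacts [p.apply_ne_top a, ENNReal.zero_ne_top]
  simp only [this, Finset.sum_mul]
  rw [Finset.sum_comm]
  refine Finset.sum_congr rfl fun a _ => ?_
  simp

theorem map_decide_eq_zero (p : PMF ℕ) : (p.map fun k => decide (k = 0)) true = p 0 := by
  rw [PMF.map_apply, tsum_eq_single 0]
  · simp
  · intro k hk
    simp [hk]

theorem sum_genMove_fst {n : ℕ} (s : Config n) (i : Fin n) (f : Bool → ℝ) :
    ∑ m, (genMove s m).toReal * f (m i).1 =
      ((s i).c 0).toReal * f true + (1 - ((s i).c 0).toReal) * f false := by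
  have h : (jobMove (s i)).map Prod.fst = (s i).c.map fun k => decide (k = 0) := by
    unfold jobMove
    simp only [PMF.map_bind, PMF.map_comp]
    exact congrArg _ (funext fun k => PMF.map_const _ _)
  rw [sum_genMove s i fun b => f b.1, sum_toReal_map (jobMove (s i)) Prod.fst f, sum_pmf_bool, h,
    map_decide_eq_zero]

theorem sum_genMove_snd {n : ℕ} (s : Config n) (i : Fin n) (f : Bool → ℝ) :
    ∑ m, (genMove s m).toReal * f (m i).2 =
      ((s i).a 0).toReal * f true + (1 - ((s i).a 0).toReal) * f false := by
  have h : (jobMove (s i)).map Prod.snd = (s i).a.map fun k => decide (k = 0) := by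
    unfold jobMove
    simp only [PMF.map_bind, PMF.map_comp]
    exact PMF.bind_const (s i).c ((s i).a.map fun k => decide (k = 0))
  rw [sum_genMove s i fun b => f b.2, sum_toReal_map (jobMove (s i)) Prod.snd f, sum_pmf_bool, h,
    map_decide_eq_zero]

/-! ### Phases determine vertices -/

namespace Task

variable (t : Task)

theorem comp_zero : t.comp 0 = 0 := by
  by_contra h
  exact absurd (t.comp_pos 0 h) (lt_irrefl 0)

theorem deadline_pos : 0 < t.deadline := by
  obtain ⟨c, hc⟩ := t.comp.support_nonempty
  exact (t.comp_pos c hc).trans_le (t.comp_le c hc)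

theorem arr_pos {a : ℕ} (ha : a ∈ t.arr.support) : 0 < a :=
  t.deadline_pos.trans_le (t.le_arr a ha)

theorem arr_zero : t.arr 0 = 0 := by
  by_contra h
  exact absurd (t.arr_pos h) (lt_irrefl 0)

/-- The phases that can occur: a complete job has received at most, and an incomplete job less
than, some possible computation time, and less than some possible inter-arrival time has passed
since the last arrival. -/
def Valid (x : Phase) : Prop :=
  (∃ c ∈ t.comp.support, x.1 ≤ c ∧ (x.2.2 = false → x.1 < c)) ∧ ∃ a ∈ t.arr.support, x.2.1 < a

theorem valid_start : t.Valid (0, 0, false) := by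
  obtain ⟨c, hc⟩ := t.comp.support_nonempty
  obtain ⟨a, ha⟩ := t.arr.support_nonempty
  exact ⟨⟨c, hc, Nat.zero_le _, fun _ => t.comp_pos c hc⟩, a, ha, t.arr_pos ha⟩

/-- The component of a vertex that a phase stands for. -/
noncomputable def job (x : Phase) : JobState where
  c := if x.2.2 then PMF.pure 0 else resid t.comp x.1
  d := t.deadline - x.2.1
  a := resid t.arr x.2.1

end Task

namespace TaskSystem

variable {n : ℕ} (Υ : TaskSystem n)

/-- The entry of the structure of the system that belongs to task `i`. -/
noncomputable def entry (i : Fin n) : Entry :=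
  (decide (i ∈ Υ.hard), (Υ.task i).comp_finite.toFinset.sort (· ≤ ·), (Υ.task i).deadline,
    (Υ.task i).arr_finite.toFinset.sort (· ≤ ·))

theorem structCode_eq : Υ.structCode = List.ofFn Υ.entry := rfl

theorem mem_entry_comp {i : Fin n} {c : ℕ} :
    c ∈ (Υ.entry i).2.1 ↔ c ∈ (Υ.task i).comp.support := by
  simp [entry]

theorem mem_entry_arr {i : Fin n} {a : ℕ} :
    a ∈ (Υ.entry i).2.2.2 ↔ a ∈ (Υ.task i).arr.support := by
  simp [entry]

/-- The vertex with the given phases of the tasks. -/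
noncomputable def conc (X : Fin n → Phase) : Config n := fun i => (Υ.task i).job (X i)

/-- All phases are valid. -/
def Valid (X : Fin n → Phase) : Prop := ∀ i, (Υ.task i).Valid (X i)

/-- The phases after an action and a move of the generator. -/
def nextPhases (X : Fin n → Phase) (act : Option (Fin n)) (m : Moves n) : Fin n → Phase :=
  fun i => Algo.next (X i) (decide (act = some i)) (m i)

/-- The action runs at most an active task, judging by the phases. -/
def ActionOK (X : Fin n → Phase) (act : Option (Fin n)) : Prop :=
  ∀ i, act = some i → Algo.active (Υ.entry i) (X i) = true

/-- The move has positive probability, judging by the phases. -/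
def MoveOK (X : Fin n → Phase) (act : Option (Fin n)) (m : Moves n) : Prop :=
  ∀ i, Algo.possible (Υ.entry i) (X i) (decide (act = some i)) (m i) = true

theorem conc_start : Υ.conc (fun _ => (0, 0, false)) = Υ.init := rfl

theorem valid_start : Υ.Valid fun _ => (0, 0, false) := fun i => (Υ.task i).valid_start

variable {Υ} {X : Fin n → Phase} {act : Option (Fin n)} {m : Moves n}

theorem active_iff (i : Fin n) :
    Algo.active (Υ.entry i) (X i) = true ↔
      (X i).2.2 = false ∧ (X i).2.1 < (Υ.task i).deadline := by
  rw [Algo.active, Bool.and_eq_true, decide_eq_true_iff]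
  simp [entry]

theorem active_conc_iff (hX : Υ.Valid X) (i : Fin n) :
    Active (Υ.conc X) i ↔ Algo.active (Υ.entry i) (X i) = true := by
  rw [active_iff]
  unfold Active conc Task.job
  simp only [Nat.sub_pos_iff_lt]
  refine and_congr_left fun _ => ?_
  cases hd : (X i).2.2
  · obtain ⟨⟨c, hc, -, h⟩, -⟩ := hX i
    simp [resid_zero_right (Υ.task i).comp_zero ⟨c, hc, h hd⟩]
  · simp

theorem allowed_conc_iff (hX : Υ.Valid X) : Allowed (Υ.conc X) act ↔ Υ.ActionOK X act :=
  forall_congr' fun i => imp_congr_right fun _ => active_conc_iff hX i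

theorem miss_iff (i : Fin n) :
    Algo.miss (Υ.entry i) (X i) (m i) = true ↔
      i ∈ Υ.hard ∧ (Υ.task i).deadline ≤ (X i).2.1 + 1 ∧ (m i).1 = false := by
  rw [Algo.miss, Bool.and_eq_true, Bool.and_eq_true, decide_eq_true_iff]
  simp [entry, and_assoc]

theorem hardMiss_iff :
    Υ.HardMiss (tick (Υ.conc X) act) m ↔
      ∃ i, Algo.miss (Υ.entry i) (X i) (m i) = true := by
  refine exists_congr fun i => ?_
  rw [miss_iff]
  refine and_congr_right fun _ => and_congr_left fun _ => ?_
  simp only [tick, conc, Task.job]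
  omega

theorem mem_support_comp_tick (hX : Υ.Valid X) (ha : Υ.ActionOK X act) (i : Fin n) (k : ℕ) :
    k ∈ (tick (Υ.conc X) act i).c.support ↔
      if (X i).2.2 then k = 0
      else if act = some i then k + ((X i).1 + 1) ∈ (Υ.task i).comp.support
      else 0 < k ∧ k + (X i).1 ∈ (Υ.task i).comp.support := by
  obtain ⟨⟨c, hc, -, h⟩, -⟩ := hX i
  simp only [tick, conc, Task.job]
  cases hd : (X i).2.2
  · have h0 := (Υ.task i).comp_zero
    by_cases hi : act = some i
    · simp only [hi, if_true]
      exact mem_support_dec_resid h0 ⟨c, hc, h hd⟩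
    · simp only [hi, if_false]
      exact mem_support_resid h0 ⟨c, hc, h hd⟩
  · have hi : act ≠ some i := fun hi => by
      have := ((active_iff i).1 (ha i hi)).1
      simp [hd] at this
    simp [hi]

theorem mem_support_arr_tick (hX : Υ.Valid X) (i : Fin n) (l : ℕ) :
    l ∈ (tick (Υ.conc X) act i).a.support ↔ l + ((X i).2.1 + 1) ∈ (Υ.task i).arr.support :=
  mem_support_dec_resid (Υ.task i).arr_zero (hX i).2

theorem possible_comp_iff (hX : Υ.Valid X) (ha : Υ.ActionOK X act) (i : Fin n) (b : Bool) :
    (∃ k ∈ (tick (Υ.conc X) act i).c.support, b = decide (k = 0)) ↔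
      (if (X i).2.2 then b else if decide (act = some i) then
        (if b then (Υ.entry i).2.1.any (fun c => decide (c = (X i).1 + 1))
          else (Υ.entry i).2.1.any (fun c => decide ((X i).1 + 1 < c))) else !b) = true := by
  simp only [mem_support_comp_tick hX ha]
  cases hd : (X i).2.2
  · by_cases hi : act = some i
    · simp only [hi, if_true, Bool.false_eq_true, if_false, decide_true]
      cases b
      · simp only [Bool.false_eq_true, if_false, List.any_eq_true, decide_eq_true_eq,
          mem_entry_comp]
        constructor
        · rintro ⟨k, hk, hb⟩
          have : k ≠ 0 := by simpa using hb.symm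
          exact ⟨_, hk, by omega⟩
        · rintro ⟨c, hc, hlt⟩
          refine ⟨c - ((X i).1 + 1), ?_, ?_⟩
          · convert hc using 1
            omega
          · have : c - ((X i).1 + 1) ≠ 0 := by omega
            simp [this]
      · simp only [if_true, List.any_eq_true, decide_eq_true_eq, mem_entry_comp]
        constructor
        · rintro ⟨k, hk, hb⟩
          have : k = 0 := by simpa using hb.symm
          subst this
          exact ⟨_, hk, by omega⟩
        · rintro ⟨c, hc, rfl⟩
          exact ⟨0, by simpa using hc, by simp⟩
    · simp only [hi, Bool.false_eq_true, if_false, decide_false]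
      obtain ⟨⟨c, hc, -, h⟩, -⟩ := hX i
      have := h hd
      cases b
      · simp only [Bool.not_false, iff_true]
        refine ⟨c - (X i).1, ⟨by omega, ?_⟩, ?_⟩
        · convert hc using 1
          omega
        · have : c - (X i).1 ≠ 0 := by omega
          simp [this]
      · simp only [Bool.not_true, Bool.false_eq_true, iff_false]
        rintro ⟨k, ⟨hk, -⟩, hb⟩
        have : k = 0 := by simpa using hb.symm
        omega
  · cases b <;> simp

theorem possible_arr_iff (hX : Υ.Valid X) (i : Fin n) (b : Bool) :
    (∃ l ∈ (tick (Υ.conc X) act i).a.support, b = decide (l = 0)) ↔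
      (if b then (Υ.entry i).2.2.2.any (fun a => decide (a = (X i).2.1 + 1))
        else (Υ.entry i).2.2.2.any (fun a => decide ((X i).2.1 + 1 < a))) = true := by
  simp only [mem_support_arr_tick hX]
  cases b
  · simp only [Bool.false_eq_true, if_false, List.any_eq_true, decide_eq_true_eq, mem_entry_arr]
    constructor
    · rintro ⟨k, hk, hb⟩
      have : k ≠ 0 := by simpa using hb.symm
      exact ⟨_, hk, by omega⟩
    · rintro ⟨c, hc, hlt⟩
      refine ⟨c - ((X i).2.1 + 1), ?_, ?_⟩
      · convert hc using 1
        omega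
      · have : c - ((X i).2.1 + 1) ≠ 0 := by omega
        simp [this]
  · simp only [if_true, List.any_eq_true, decide_eq_true_eq, mem_entry_arr]
    constructor
    · rintro ⟨k, hk, hb⟩
      have : k = 0 := by simpa using hb.symm
      subst this
      exact ⟨_, hk, by omega⟩
    · rintro ⟨c, hc, rfl⟩
      exact ⟨0, by simpa using hc, by simp⟩

theorem mem_support_iff_moveOK (hX : Υ.Valid X) (ha : Υ.ActionOK X act) :
    m ∈ (genMove (tick (Υ.conc X) act)).support ↔ Υ.MoveOK X act m := by
  rw [mem_support_genMove]
  refine forall_congr' fun i => ?_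
  rw [mem_support_jobMove, possible_comp_iff hX ha, possible_arr_iff hX, Algo.possible,
    Bool.and_eq_true]

/-- What a possible move says about completion. -/
theorem moveOK_comp (h : Υ.MoveOK X act m) (i : Fin n) :
    ((X i).2.2 = true → (m i).1 = true) ∧
    ((X i).2.2 = false → act ≠ some i → (m i).1 = false) ∧
    ((X i).2.2 = false → act = some i → (m i).1 = true →
      (X i).1 + 1 ∈ (Υ.task i).comp.support) ∧
    ((X i).2.2 = false → act = some i → (m i).1 = false →
      ∃ c ∈ (Υ.task i).comp.support, (X i).1 + 1 < c) := by
  have := (Bool.and_eq_true _ _ ▸ h i : _ ∧ _).1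
  refine ⟨fun hd => ?_, fun hd hi => ?_, fun hd hi hm => ?_, fun hd hi hm => ?_⟩
  · simpa [hd] using this
  · simpa [hd, hi] using this
  · simpa [hd, hi, hm, mem_entry_comp] using this
  · simpa [hd, hi, hm, mem_entry_comp] using this

/-- What a possible move says about arrivals. -/
theorem moveOK_arr (h : Υ.MoveOK X act m) (i : Fin n) :
    ((m i).2 = true → (X i).2.1 + 1 ∈ (Υ.task i).arr.support) ∧
    ((m i).2 = false → ∃ a ∈ (Υ.task i).arr.support, (X i).2.1 + 1 < a) := by
  have := (Bool.and_eq_true _ _ ▸ h i : _ ∧ _).2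
  refine ⟨fun hm => ?_, fun hm => ?_⟩
  · simpa [hm, mem_entry_arr] using this
  · simpa [hm, mem_entry_arr] using this

theorem valid_nextPhases (hX : Υ.Valid X) (ha : Υ.ActionOK X act) (h : Υ.MoveOK X act m) :
    Υ.Valid (nextPhases X act m) := by
  intro i
  obtain ⟨⟨c, hc, hle, hlt⟩, -⟩ := hX i
  obtain ⟨c1, c2, c3, c4⟩ := moveOK_comp h i
  obtain ⟨a1, a2⟩ := moveOK_arr h i
  unfold nextPhases Algo.next
  cases hm2 : (m i).2
  · simp only [Bool.false_eq_true, if_false]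
    refine ⟨?_, a2 hm2⟩
    by_cases hi : act = some i
    · have hd := ((active_iff i).1 (ha i hi)).1
      simp only [hi, decide_true, if_true]
      cases hm : (m i).1
      · obtain ⟨c, hc, h⟩ := c4 hd hi hm
        exact ⟨c, hc, h.le, fun _ => h⟩
      · exact ⟨_, c3 hd hi hm, le_rfl, by simp⟩
    · simp only [hi, decide_false, Bool.false_eq_true, if_false]
      refine ⟨c, hc, hle, fun hm => hlt ?_⟩
      by_contra hd
      rw [c1 (by simpa using hd)] at hm
      exact absurd hm (by simp)
  · exact (Υ.task i).valid_start

theorem resolve_conc (hX : Υ.Valid X) (h : Υ.MoveOK X act m) :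
    Υ.resolve (tick (Υ.conc X) act) m = Υ.conc (nextPhases X act m) := by
  funext i
  obtain ⟨⟨c, hc, hle, hlt⟩, -⟩ := hX i
  obtain ⟨c1, c2, c3, c4⟩ := moveOK_comp h i
  change _ = (Υ.task i).job (Algo.next (X i) (decide (act = some i)) (m i))
  simp only [resolve, Algo.next]
  cases hm2 : (m i).2
  · simp only [Bool.false_eq_true, if_false, Task.job, tick, conc]
    congr 1
    cases hm : (m i).1
    · have hd : (X i).2.2 = false := by
        by_contra hd
        rw [c1 (by simpa using hd)] at hm
        exact absurd hm (by simp)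
      by_cases hi : act = some i
      · simp [hi, hd, resid]
      · simp only [hi, hd, Bool.false_eq_true, if_false, decide_false]
        exact renorm_eq_self (resid_zero_right (Υ.task i).comp_zero ⟨c, hc, hlt hd⟩)
    · simp
  · rfl

end TaskSystem

/-! ### The safety game -/

namespace Algo

theorem map_range_eq_ofFn {α : Type*} (n : ℕ) (f : ℕ → α) :
    (List.range n).map f = List.ofFn fun i : Fin n => f i := by
  apply List.ext_getElem <;> simp

theorem getD_ofFn {α : Type*} {n : ℕ} (f : Fin n → α) (i : Fin n) (d : α) :
    (List.ofFn f).getD i d = f i := by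
  simp

theorem mem_choices_ofFn {α : Type*} {n : ℕ} (F : Fin n → List α) (l : List α) :
    l ∈ choices (List.ofFn F) ↔ ∃ g : Fin n → α, (∀ i, g i ∈ F i) ∧ l = List.ofFn g := by
  induction n generalizing l with
  | zero => simp [choices]
  | succ n ih =>
    have h : choices (List.ofFn F) =
        (F 0).flatMap fun x => (choices (List.ofFn fun i : Fin n => F i.succ)).map
          fun y => x :: y := by
      rw [List.ofFn_succ]
      rfl
    rw [h]
    simp only [List.mem_flatMap, List.mem_map, ih]
    constructor
    · rintro ⟨x, hx, _, ⟨g, hg, rfl⟩, rfl⟩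
      refine ⟨Fin.cons x g, fun i => ?_, ?_⟩
      · refine Fin.cases ?_ (fun i => ?_) i
        · simpa using hx
        · simpa using hg i
      · simp [List.ofFn_succ]
    · rintro ⟨g, hg, rfl⟩
      exact ⟨g 0, hg 0, _, ⟨fun i => g i.succ, fun i => hg i.succ, rfl⟩,
        by simp [List.ofFn_succ]⟩

theorem bound_pos (s : StructCode) : 0 < bound s := by
  induction s with
  | nil => exact Nat.one_pos
  | cons u s ih => exact lt_of_lt_of_le ih (Nat.le_add_left _ _)

theorem lt_bound {s : StructCode} {t : Entry} (ht : t ∈ s) :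
    t.2.1.sum + t.2.2.2.sum < bound s := by
  induction s with
  | nil => simp at ht
  | cons u s ih =>
    have h : bound (u :: s) = u.2.1.sum + u.2.2.2.sum + bound s := rfl
    have h0 := bound_pos s
    rcases List.mem_cons.1 ht with rfl | ht
    · omega
    · have := ih ht
      omega

theorem refine_sublist (s : StructCode) (W : List (List Phase)) :
    List.Sublist (refine s W) W := List.filter_sublist

/-- Removing vertices without a good action stops after as many rounds as there are vertices. -/
theorem refine_safeSet (s : StructCode) : refine s (safeSet s) = safeSet s := by
  have h : ∀ k, refine s ((refine s)^[k] (vertices s)) = (refine s)^[k] (vertices s) ∨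
      ((refine s)^[k] (vertices s)).length + k ≤ (vertices s).length := fun k => by
    induction k with
    | zero => exact Or.inr le_rfl
    | succ k ih =>
      rw [Function.iterate_succ_apply']
      rcases ih with ih | ih
      · left
        rw [ih, ih]
      · by_cases he : refine s ((refine s)^[k] (vertices s)) = (refine s)^[k] (vertices s)
        · left
          rw [he, he]
        · right
          have h1 := (refine_sublist s ((refine s)^[k] (vertices s))).length_le
          have h2 : (refine s ((refine s)^[k] (vertices s))).length ≠
              ((refine s)^[k] (vertices s)).length := fun h =>
            he ((refine_sublist s _).eq_of_length h)
          omega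
  rcases h (vertices s).length with h | h
  · exact h
  · have : safeSet s = [] := List.length_eq_zero_iff.1 (by unfold safeSet; omega)
    rw [this]
    rfl

end Algo

namespace TaskSystem

variable {n : ℕ} {Υ : TaskSystem n} {X : Fin n → Phase} {act : Option (Fin n)} {m : Moves n}
  {σ : Config n → Option (Fin n)}

theorem decide_map_val_eq (act : Option (Fin n)) (i : Fin n) :
    decide (act.map Fin.val = some (i : ℕ)) = decide (act = some i) := by
  rw [decide_eq_decide]
  cases act <;> simp [Fin.ext_iff]

theorem nextAll_ofFn :
    Algo.nextAll (List.ofFn X) (act.map Fin.val) (List.ofFn m) =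
      List.ofFn (nextPhases X act m) := by
  unfold Algo.nextAll
  rw [List.length_ofFn, Algo.map_range_eq_ofFn]
  congr 1
  funext i
  rw [Algo.getD_ofFn, Algo.getD_ofFn, decide_map_val_eq]
  rfl

theorem mem_moves_ofFn (l : List (Bool × Bool)) :
    l ∈ Algo.moves Υ.structCode (List.ofFn X) (act.map Fin.val) ↔
      ∃ m : Moves n, Υ.MoveOK X act m ∧ l = List.ofFn m := by
  unfold Algo.moves
  rw [structCode_eq, List.length_ofFn, Algo.map_range_eq_ofFn, Algo.mem_choices_ofFn]
  refine exists_congr fun g => and_congr_left fun _ => forall_congr' fun i => ?_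
  rw [Algo.getD_ofFn, Algo.getD_ofFn, decide_map_val_eq, Algo.movesOne, List.mem_filter,
    and_iff_right]
  generalize g i = b
  revert b
  decide

theorem all_range_iff {p : ℕ → Bool} : (List.range n).all p = true ↔ ∀ i : Fin n, p i = true := by
  rw [List.all_eq_true]
  exact ⟨fun h i => h i (List.mem_range.2 i.2), fun h k hk => h ⟨k, List.mem_range.1 hk⟩⟩

theorem good_iff (W : List (List Phase)) :
    Algo.good Υ.structCode W (List.ofFn X) (act.map Fin.val) = true ↔
      Υ.ActionOK X act ∧ ∀ m, Υ.MoveOK X act m →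
        (∀ i, ¬ Algo.miss (Υ.entry i) (X i) (m i) = true) ∧
        List.ofFn (nextPhases X act m) ∈ W := by
  have hl : Υ.structCode.length = n := by rw [structCode_eq, List.length_ofFn]
  unfold Algo.good
  rw [Bool.and_eq_true, hl, all_range_iff, List.all_eq_true]
  refine and_congr (forall_congr' fun i => ?_) ⟨fun h m hm => ?_, fun h ms hms => ?_⟩
  · rw [structCode_eq, Algo.getD_ofFn, Algo.getD_ofFn, decide_map_val_eq]
    by_cases hi : act = some i <;> simp [hi]
  · have := h _ ((mem_moves_ofFn _).2 ⟨m, hm, rfl⟩)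
    rw [Bool.and_eq_true, all_range_iff, nextAll_ofFn] at this
    refine ⟨fun i => ?_, by simpa using this.2⟩
    have := this.1 i
    rw [structCode_eq, Algo.getD_ofFn, Algo.getD_ofFn, Algo.getD_ofFn] at this
    simpa using this
  · obtain ⟨m, hm, rfl⟩ := (mem_moves_ofFn _).1 hms
    obtain ⟨h1, h2⟩ := h m hm
    rw [Bool.and_eq_true, all_range_iff, nextAll_ofFn]
    refine ⟨fun i => ?_, by simpa using h2⟩
    rw [structCode_eq, Algo.getD_ofFn, Algo.getD_ofFn, Algo.getD_ofFn]
    simpa using h1 i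

theorem mem_actions_iff (W : List (List Phase)) (r : Option ℕ) :
    r ∈ Algo.actions Υ.structCode W (List.ofFn X) ↔
      ∃ act : Option (Fin n), r = act.map Fin.val ∧
        Algo.good Υ.structCode W (List.ofFn X) (act.map Fin.val) = true := by
  have hl : Υ.structCode.length = n := by rw [structCode_eq, List.length_ofFn]
  unfold Algo.actions
  rw [hl, List.mem_filter, List.mem_cons, List.mem_map]
  constructor
  · rintro ⟨rfl | ⟨k, hk, rfl⟩, h⟩
    · exact ⟨none, rfl, h⟩
    · exact ⟨some ⟨k, List.mem_range.1 hk⟩, rfl, h⟩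
  · rintro ⟨act, rfl, h⟩
    refine ⟨?_, h⟩
    cases act with
    | none => exact Or.inl rfl
    | some i => exact Or.inr ⟨i, List.mem_range.2 i.2, rfl⟩

/-! #### Plays -/

/-- A play is extended at the front. -/
theorem IsPlay.cons {s : ℕ → Config n} {m : ℕ → Moves n} (h : Υ.IsPlay σ s m) {s₀ : Config n}
    {m₀ : Moves n} (hm : m₀ ∈ (genMove (tick s₀ (σ s₀))).support)
    (hs : s 0 = Υ.resolve (tick s₀ (σ s₀)) m₀) :
    Υ.IsPlay σ (fun k => Nat.casesOn k s₀ s) (fun k => Nat.casesOn k m₀ m)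
  | 0 => ⟨hm, hs⟩
  | k + 1 => h k

/-- If the generator chooses its move as a function of the vertex, the play is determined. -/
theorem exists_isPlay (σ : Config n → Option (Fin n)) (pick : Config n → Moves n)
    (hp : ∀ s, pick s ∈ (genMove (tick s (σ s))).support) (s₀ : Config n) :
    ∃ s : ℕ → Config n, Υ.IsPlay σ s (fun k => pick (s k)) ∧ s 0 = s₀ :=
  ⟨fun k => (fun s => Υ.resolve (tick s (σ s)) (pick s))^[k] s₀,
    fun _ => ⟨hp _, Function.iterate_succ_apply' _ _ _⟩, rfl⟩

theorem exists_isPlay_from (σ : Config n → Option (Fin n)) (s₀ : Config n) :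
    ∃ s m, Υ.IsPlay σ s m ∧ s 0 = s₀ := by
  obtain ⟨s, h⟩ := exists_isPlay (Υ := Υ) σ
    (fun s => (genMove (tick s (σ s))).support_nonempty.some)
    (fun s => (genMove (tick s (σ s))).support_nonempty.some_mem) s₀
  exact ⟨s, _, h⟩

theorem SafeFrom.not_hardMiss {s : Config n} (h : Υ.SafeFrom σ s)
    (hm : m ∈ (genMove (tick s (σ s))).support) : ¬ Υ.HardMiss (tick s (σ s)) m := by
  obtain ⟨s', m', hp, h0⟩ := exists_isPlay_from (Υ := Υ) σ (Υ.resolve (tick s (σ s)) m)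
  exact h.2 _ _ (hp.cons hm h0) rfl 0

theorem SafeFrom.resolve {s : Config n} (h : Υ.SafeFrom σ s)
    (hm : m ∈ (genMove (tick s (σ s))).support) :
    Υ.SafeFrom σ (Υ.resolve (tick s (σ s)) m) :=
  ⟨h.1, fun _ _ hp h0 k => h.2 _ _ (hp.cons hm h0) rfl (k + 1)⟩

/-! #### The computed set of safe vertices -/

/-- The vertex is in the safe set computed by the algorithm. -/
def Safe (Υ : TaskSystem n) (X : Fin n → Phase) : Prop :=
  List.ofFn X ∈ Algo.safeSet Υ.structCode

/-- The action is safe according to the algorithm. -/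
def Good (Υ : TaskSystem n) (X : Fin n → Phase) (act : Option (Fin n)) : Prop :=
  Algo.good Υ.structCode (Algo.safeSet Υ.structCode) (List.ofFn X) (act.map Fin.val) = true

theorem comp_lt_bound {i : Fin n} {c : ℕ} (hc : c ∈ (Υ.task i).comp.support) :
    c < Algo.bound Υ.structCode := by
  have h1 : Υ.entry i ∈ Υ.structCode := by
    rw [structCode_eq]
    exact List.mem_ofFn.2 ⟨i, rfl⟩
  have h2 := Algo.lt_bound h1
  have h3 := List.le_sum_of_mem (Υ.mem_entry_comp.2 hc)
  omega

theorem arr_lt_bound {i : Fin n} {a : ℕ} (ha : a ∈ (Υ.task i).arr.support) :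
    a < Algo.bound Υ.structCode := by
  have h1 : Υ.entry i ∈ Υ.structCode := by
    rw [structCode_eq]
    exact List.mem_ofFn.2 ⟨i, rfl⟩
  have h2 := Algo.lt_bound h1
  have h3 := List.le_sum_of_mem (Υ.mem_entry_arr.2 ha)
  omega

theorem Valid.mem_vertices (hX : Υ.Valid X) : List.ofFn X ∈ Algo.vertices Υ.structCode := by
  unfold Algo.vertices
  generalize hB : Algo.bound Υ.structCode = B
  rw [structCode_eq, List.map_ofFn, Algo.mem_choices_ofFn]
  refine ⟨X, fun i => ?_, rfl⟩
  obtain ⟨⟨c, hc, hle, -⟩, a, ha, hlt⟩ := hX i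
  subst hB
  simp only [Function.comp_apply, List.mem_flatMap, List.mem_range]
  refine ⟨(X i).1, hle.trans_lt (comp_lt_bound hc), (X i).2.1, hlt.trans (arr_lt_bound ha), ?_⟩
  rcases X i with ⟨e, b, _ | _⟩ <;> simp

theorem SafeFrom.good {W : List (List Phase)} (hX : Υ.Valid X) (h : Υ.SafeFrom σ (Υ.conc X))
    (hW : ∀ Y, Υ.Valid Y → Υ.SafeFrom σ (Υ.conc Y) → List.ofFn Y ∈ W) :
    Algo.good Υ.structCode W (List.ofFn X) ((σ (Υ.conc X)).map Fin.val) = true := by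
  have ha : Υ.ActionOK X (σ (Υ.conc X)) := (allowed_conc_iff hX).1 (h.1 _)
  refine (good_iff W).2 ⟨ha, fun m hm => ?_⟩
  have hm' := (mem_support_iff_moveOK hX ha).2 hm
  refine ⟨fun i hi => h.not_hardMiss hm' (hardMiss_iff.2 ⟨i, hi⟩), ?_⟩
  refine hW _ (valid_nextPhases hX ha hm) ?_
  rw [← resolve_conc hX hm]
  exact h.resolve hm'

/-- The computed set contains all vertices from which there is a safe strategy. -/
theorem SafeFrom.safe (hX : Υ.Valid X) (h : Υ.SafeFrom σ (Υ.conc X)) : Υ.Safe X := by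
  have : ∀ k (Y : Fin n → Phase), Υ.Valid Y → Υ.SafeFrom σ (Υ.conc Y) →
      List.ofFn Y ∈ (Algo.refine Υ.structCode)^[k] (Algo.vertices Υ.structCode) := fun k => by
    induction k with
    | zero => exact fun Y hY _ => hY.mem_vertices
    | succ k ih =>
      intro Y hY hs
      rw [Function.iterate_succ_apply']
      refine List.mem_filter.2 ⟨ih Y hY hs, ?_⟩
      rw [decide_eq_true_iff]
      exact List.length_pos_of_mem ((mem_actions_iff _ _).2 ⟨_, rfl, hs.good hY ih⟩)
  exact this _ X hX h

/-- Safe edges are offered by the algorithm. -/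
theorem SafeEdge.good (hX : Υ.Valid X) (h : Υ.SafeEdge (Υ.conc X) act) : Υ.Good X act := by
  obtain ⟨σ, hσ, rfl⟩ := h
  exact hσ.good hX fun Y hY hs => hs.safe hY

/-- In a vertex of the computed set some action is good. -/
theorem Safe.exists_good (h : Υ.Safe X) : ∃ act, Υ.Good X act := by
  unfold Safe at h
  rw [← Algo.refine_safeSet] at h
  have := (List.mem_filter.1 h).2
  rw [decide_eq_true_iff] at this
  obtain ⟨r, hr⟩ := List.exists_mem_of_length_pos this
  obtain ⟨act, -, ha⟩ := (mem_actions_iff _ _).1 hr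
  exact ⟨act, ha⟩

theorem Good.actionOK (h : Υ.Good X act) : Υ.ActionOK X act := ((good_iff _).1 h).1

theorem Good.not_miss (h : Υ.Good X act) (hm : Υ.MoveOK X act m) (i : Fin n) :
    ¬ Algo.miss (Υ.entry i) (X i) (m i) = true := (((good_iff _).1 h).2 m hm).1 i

theorem Good.safe (h : Υ.Good X act) (hm : Υ.MoveOK X act m) : Υ.Safe (nextPhases X act m) :=
  (((good_iff _).1 h).2 m hm).2

theorem effective_conc (hX : Υ.Valid X) (ha : Υ.ActionOK X act) :
    effective (Υ.conc X) (act.map Fin.val) = act := by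
  cases act with
  | none => rfl
  | some i =>
    have : Active (Υ.conc X) i := (active_conc_iff hX i).2 (ha i rfl)
    simp [effective, this]

end TaskSystem

/-! ### The memory of the learner -/

/-- Number of observations that a sampler has used so far: every finished sample `x` took `x` of
them. -/
def Sampler.used (q : Sampler) : ℕ := q.2.sum + q.1

/-- The sampler collects samples of a law with the given support: its level is below some possible
value, the samples are possible values, and it starts no further sample after the `N`-th. -/
def Sampler.OK (N : ℕ) (S : Set ℕ) (q : Sampler) : Prop :=
  (∃ c ∈ S, q.1 < c) ∧ (∀ x ∈ q.2, x ∈ S) ∧ q.2.length ≤ N ∧ (q.2.length = N → q.1 = 0)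

namespace Algo

variable {N : ℕ} {S : Set ℕ} {q : Sampler} {run success : Bool} {level : ℕ}

theorem sample_of_not (h : ¬ (run = true ∧ level = q.1 ∧ q.2.length < N)) :
    sample N run level success q = q := by
  unfold sample
  rw [if_neg]
  simpa [and_assoc] using h

theorem sample_true (hl : level = q.1) (hN : q.2.length < N) :
    sample N true level true q = (0, (q.1 + 1) :: q.2) := by
  simp [sample, hl, hN]

theorem sample_false (hl : level = q.1) (hN : q.2.length < N) :
    sample N true level false q = (q.1 + 1, q.2) := by
  simp [sample, hl, hN]

theorem used_sample (hl : level = q.1) (hN : q.2.length < N) :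
    (sample N true level success q).used = q.used + 1 := by
  cases success
  · rw [sample_false hl hN]
    simp [Sampler.used]
    ring
  · rw [sample_true hl hN]
    simp [Sampler.used]
    ring

theorem used_le_sample : q.used ≤ (sample N run level success q).used := by
  by_cases h : run = true ∧ level = q.1 ∧ q.2.length < N
  · obtain ⟨rfl, hl, hN⟩ := h
    rw [used_sample hl hN]
    exact Nat.le_succ _
  · rw [sample_of_not h]

theorem length_le_sample : q.2.length ≤ (sample N run level success q).2.length := by
  by_cases h : run = true ∧ level = q.1 ∧ q.2.length < N
  · obtain ⟨rfl, hl, hN⟩ := h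
    cases success
    · rw [sample_false hl hN]
    · rw [sample_true hl hN]
      simp
  · rw [sample_of_not h]

theorem ok_sample (h : q.OK N S) (h1 : run = true → level = q.1 → success = true → level + 1 ∈ S)
    (h2 : run = true → level = q.1 → success = false → ∃ c ∈ S, level + 1 < c) :
    (sample N run level success q).OK N S := by
  by_cases ht : run = true ∧ level = q.1 ∧ q.2.length < N
  · obtain ⟨rfl, hl, hN⟩ := ht
    obtain ⟨⟨c, hc, hlt⟩, hs, -, -⟩ := h
    cases success
    · rw [sample_false hl hN]
      obtain ⟨c, hc, hlt⟩ := h2 rfl hl rfl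
      exact ⟨⟨c, hc, hl ▸ hlt⟩, hs, hN.le, fun h => absurd h hN.ne⟩
    · rw [sample_true hl hN]
      refine ⟨⟨c, hc, by dsimp only; omega⟩, fun x hx => ?_, hN, fun _ => rfl⟩
      rcases List.mem_cons.1 hx with rfl | hx
      · exact hl ▸ h1 rfl hl rfl
      · exact hs x hx
  · rwa [sample_of_not ht]

end Algo

namespace TaskSystem

variable {n : ℕ} {Υ : TaskSystem n} {N : ℕ}

/-- The phases that are recorded in the memory. -/
abbrev phases (Z : Fin n → Algo.Memo) : Fin n → Phase := fun i => (Z i).1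

/-- The memory after an action and a move of the generator. -/
def nextMemo (N : ℕ) (Z : Fin n → Algo.Memo) (act : Option (Fin n)) (m : Moves n) :
    Fin n → Algo.Memo :=
  fun i => Algo.update N (Z i) (decide (act = some i)) (m i)

/-- The memory after a finite execution. -/
def memoryOf (N : ℕ) : History n → Fin n → Algo.Memo
  | [] => fun _ => Algo.start
  | x :: h => nextMemo N (memoryOf N h) x.1 x.2

theorem memory_observation (h : History n) :
    Algo.memory N n (History.observation h) = List.ofFn (memoryOf N h) := by
  induction h with
  | nil => exact Algo.map_range_eq_ofFn n _
  | cons x h ih =>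
    have e : Algo.memory N n (History.observation (x :: h)) =
        (List.range n).map fun i => Algo.update N ((Algo.memory N n (History.observation h)).getD i Algo.start)
          (decide (x.1.map Fin.val = some i)) ((List.ofFn x.2).getD i default) := rfl
    rw [e, ih, Algo.map_range_eq_ofFn]
    congr 1
    funext i
    rw [Algo.getD_ofFn, Algo.getD_ofFn, decide_map_val_eq]
    rfl

/-- The memory `Z` can occur after `t` ticks. -/
inductive Reach (Υ : TaskSystem n) (N : ℕ) : ℕ → (Fin n → Algo.Memo) → Prop
  | zero : Reach Υ N 0 fun _ => Algo.start
  | succ {t : ℕ} {Z : Fin n → Algo.Memo} {act : Option (Fin n)} {m : Moves n} :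
      Reach Υ N t Z → Υ.Good (phases Z) act → Υ.MoveOK (phases Z) act m →
      Reach Υ N (t + 1) (nextMemo N Z act m)

/-- One tick under the control of the learner can change the memory from `Z` to `Z'`. -/
def Step (Υ : TaskSystem n) (N : ℕ) (Z Z' : Fin n → Algo.Memo) : Prop :=
  ∃ act m, Υ.Good (phases Z) act ∧ Υ.MoveOK (phases Z) act m ∧ Z' = nextMemo N Z act m

/-- Invariant of the memory for task `i`. -/
structure MemoOK (Υ : TaskSystem n) (N : ℕ) (i : Fin n) (y : Algo.Memo) : Prop where
  valid : (Υ.task i).Valid y.1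
  le : y.1.1 ≤ y.1.2.1
  comp : y.2.1.OK N (Υ.task i).comp.support
  arr : y.2.2.OK N (Υ.task i).arr.support
  level : y.2.2.2.length < N → y.2.2.1 = y.1.2.1

variable {t : ℕ} {Z Z' : Fin n → Algo.Memo} {act : Option (Fin n)} {m : Moves n}

theorem Reach.memoOK (h : Υ.Reach N t Z) : ∀ i, Υ.MemoOK N i (Z i) := by
  induction h with
  | zero =>
    intro i
    obtain ⟨⟨c, hc, -, h1⟩, a, ha, h2⟩ := (Υ.task i).valid_start
    refine ⟨(Υ.task i).valid_start, le_rfl, ⟨⟨c, hc, h1 rfl⟩, ?_, Nat.zero_le _, fun _ => rfl⟩,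
      ⟨⟨a, ha, h2⟩, ?_, Nat.zero_le _, fun _ => rfl⟩, fun _ => rfl⟩ <;> simp [Algo.start]
  | @succ t Z act m h hg hm ih =>
    intro i
    have hv := valid_nextPhases (fun i => (ih i).valid) hg.actionOK hm i
    obtain ⟨c1, c2, c3, c4⟩ := moveOK_comp hm i
    obtain ⟨a1, a2⟩ := moveOK_arr hm i
    have hd : decide (act = some i) = true → (Z i).1.2.2 = false := fun hi =>
      ((active_iff i).1 (hg.actionOK i (by simpa using hi))).1
    refine ⟨hv, ?_, ?_, ?_, ?_⟩
    · have := (ih i).le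
      simp only [nextMemo, Algo.update, Algo.next]
      cases (m i).2
      · simp only [Bool.false_eq_true, if_false]
        split_ifs <;> omega
      · simp
    · refine Algo.ok_sample (ih i).comp (fun hi _ hs => c3 (hd hi) (by simpa using hi) hs)
        (fun hi _ hs => c4 (hd hi) (by simpa using hi) hs)
    · exact Algo.ok_sample (ih i).arr (fun _ _ hs => a1 hs) (fun _ _ hs => a2 hs)
    · intro hN
      simp only [nextMemo, Algo.update] at hN ⊢
      have hN' : (Z i).2.2.2.length < N := lt_of_le_of_lt Algo.length_le_sample hN
      have hl := ((ih i).level hN').symm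
      simp only [Algo.next]
      cases (m i).2
      · rw [Algo.sample_false hl hN', hl]
        simp
      · rw [Algo.sample_true hl hN']
        simp

theorem Reach.valid (h : Υ.Reach N t Z) : Υ.Valid (phases Z) := fun i => (h.memoOK i).valid

theorem Reach.safe (hs : Υ.Schedulable) (h : Υ.Reach N t Z) : Υ.Safe (phases Z) := by
  cases h with
  | zero =>
    obtain ⟨σ, hσ⟩ := hs
    exact SafeFrom.safe Υ.valid_start hσ
  | succ h hg hm => exact hg.safe hm

/-- The time of the last arrival is a sum of inter-arrival times. -/
theorem Reach.exists_last_arrival (h : Υ.Reach N t Z) (i : Fin n) :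
    ∃ τ ∈ AddSubmonoid.closure (Υ.task i).arr.support, t = τ + (Z i).1.2.1 := by
  induction h with
  | zero => exact ⟨0, zero_mem _, rfl⟩
  | @succ t Z act m h hg hm ih =>
    obtain ⟨τ, hτ, e⟩ := ih
    simp only [nextMemo, Algo.update, Algo.next]
    cases hmi : (m i).2
    · exact ⟨τ, hτ, by simp only [Bool.false_eq_true, if_false]; omega⟩
    · have := AddSubmonoid.subset_closure ((moveOK_arr hm i).1 hmi)
      exact ⟨τ + ((Z i).1.2.1 + 1), add_mem hτ this, by simp only [if_true]; omega⟩

theorem Reach.step (h : Υ.Reach N t Z) (hs : Υ.Step N Z Z') : Υ.Reach N (t + 1) Z' := by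
  obtain ⟨act, m, hg, hm, rfl⟩ := hs
  exact h.succ hg hm

/-- `Z'` can be reached from `Z`. -/
abbrev Path (Υ : TaskSystem n) (N : ℕ) : (Fin n → Algo.Memo) → (Fin n → Algo.Memo) → Prop :=
  Relation.ReflTransGen (Υ.Step N)

theorem Reach.path (h : Υ.Reach N t Z) (hp : Υ.Path N Z Z') : ∃ t', Υ.Reach N t' Z' := by
  induction hp with
  | refl => exact ⟨t, h⟩
  | tail _ hs ih =>
    obtain ⟨t', h'⟩ := ih
    exact ⟨_, h'.step hs⟩

/-- Number of observations that all samplers have used. -/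
def used (Z : Fin n → Algo.Memo) : ℕ := ∑ i, ((Z i).2.1.used + (Z i).2.2.used)

theorem used_le_nextMemo : used Z ≤ used (nextMemo N Z act m) :=
  Finset.sum_le_sum fun _ _ => Nat.add_le_add Algo.used_le_sample Algo.used_le_sample

theorem used_lt_nextMemo (i : Fin n)
    (h : (act = some i ∧ (Z i).1.1 = (Z i).2.1.1 ∧ (Z i).2.1.2.length < N) ∨
      ((Z i).1.2.1 = (Z i).2.2.1 ∧ (Z i).2.2.2.length < N)) :
    used Z < used (nextMemo N Z act m) := by
  refine Finset.sum_lt_sum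
    (fun _ _ => Nat.add_le_add Algo.used_le_sample Algo.used_le_sample) ⟨i, Finset.mem_univ i, ?_⟩
  rcases h with ⟨ha, hl, hN⟩ | ⟨hl, hN⟩
  · refine Nat.add_lt_add_of_lt_of_le ?_ Algo.used_le_sample
    simp only [nextMemo, Algo.update, ha, decide_true]
    rw [Algo.used_sample hl hN]
    exact Nat.lt_succ_self _
  · refine Nat.add_lt_add_of_le_of_lt Algo.used_le_sample ?_
    simp only [nextMemo, Algo.update]
    rw [Algo.used_sample hl hN]
    exact Nat.lt_succ_self _

theorem used_le_path (hp : Υ.Path N Z Z') : used Z ≤ used Z' := by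
  induction hp with
  | refl => exact le_rfl
  | tail _ hs ih =>
    obtain ⟨act, m, -, -, rfl⟩ := hs
    exact ih.trans used_le_nextMemo

/-- If no sampler uses an observation, nothing changes. -/
theorem used_lt_or_eq_path (hp : Υ.Path N Z Z') (i : Fin n) :
    used Z < used Z' ∨ (Z' i).2.1 = (Z i).2.1 := by
  induction hp with
  | refl => exact Or.inr rfl
  | @tail Z₁ _ _ hs ih =>
    obtain ⟨act, m, -, -, rfl⟩ := hs
    rcases ih with ih | ih
    · exact Or.inl (ih.trans_le used_le_nextMemo)
    by_cases h : decide (act = some i) = true ∧ (Z₁ i).1.1 = (Z₁ i).2.1.1 ∧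
        (Z₁ i).2.1.2.length < N
    · refine Or.inl ((used_le_path ‹_›).trans_lt (used_lt_nextMemo i (Or.inl ?_)))
      simpa using h
    · exact Or.inr (ih ▸ Algo.sample_of_not h)

/-! ### Return to the initial vertex -/

theorem exists_moveOK {X : Fin n → Phase} (hX : Υ.Valid X) (ha : Υ.ActionOK X act) :
    ∃ m, Υ.MoveOK X act m := by
  obtain ⟨m, hm⟩ := (genMove (tick (Υ.conc X) act)).support_nonempty
  exact ⟨m, (mem_support_iff_moveOK hX ha).1 hm⟩

/-- Completions and arrivals are independent. -/
theorem MoveOK.replace_arr {X : Fin n → Phase} (hm : Υ.MoveOK X act m) (b : Fin n → Bool)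
    (h1 : ∀ i, b i = true → (X i).2.1 + 1 ∈ (Υ.task i).arr.support)
    (h2 : ∀ i, b i = false → ∃ a ∈ (Υ.task i).arr.support, (X i).2.1 + 1 < a) :
    Υ.MoveOK X act fun i => ((m i).1, b i) := by
  intro i
  have h := (Bool.and_eq_true _ _ ▸ hm i : _ ∧ _).1
  refine (Bool.and_eq_true _ _).symm ▸ ⟨h, ?_⟩
  dsimp only
  by_cases hb : b i = true
  · simpa [hb, mem_entry_arr] using h1 i hb
  · have hb' : b i = false := by simpa using hb
    simpa [hb', mem_entry_arr] using h2 i hb'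

/-- In state `b`, counted from the last arrival, a task can submit a job in exactly `r` ticks. -/
def CanArrive (t : Task) (b r : ℕ) : Prop :=
  ∃ g ∈ t.arr.support, b < g ∧ ∃ y ∈ AddSubmonoid.closure t.arr.support, r + b = g + y

theorem canArrive_zero {t : Task} {r : ℕ} (hr : r ∈ AddSubmonoid.closure t.arr.support)
    (h : r ≠ 0) : CanArrive t 0 r := by
  obtain ⟨l, hl, rfl⟩ := AddSubmonoid.exists_list_of_mem_closure hr
  cases l with
  | nil => simp at h
  | cons g l =>
    refine ⟨g, hl g (by simp), t.arr_pos (hl g (by simp)), l.sum, ?_, by simp⟩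
    exact AddSubmonoid.list_sum_mem _ fun x hx =>
      AddSubmonoid.subset_closure (hl x (List.mem_cons_of_mem _ hx))

/-- If every task can submit a job in exactly `r` ticks, then all can do so simultaneously. -/
theorem Reach.path_start (hs : Υ.Schedulable) (r : ℕ) (h : Υ.Reach N t Z)
    (hr : ∀ i, CanArrive (Υ.task i) (Z i).1.2.1 (r + 1)) :
    ∃ Z', Υ.Path N Z Z' ∧ phases Z' = fun _ => (0, 0, false) := by
  induction r generalizing t Z with
  | zero =>
    obtain ⟨act, hg⟩ := (h.safe hs).exists_good
    obtain ⟨m, hm⟩ := exists_moveOK h.valid hg.actionOK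
    have h1 : ∀ i, (Z i).1.2.1 + 1 ∈ (Υ.task i).arr.support := fun i => by
      obtain ⟨g, hg, hlt, y, -, e⟩ := hr i
      have hgb : (Z i).1.2.1 + 1 = g := by omega
      exact hgb ▸ hg
    have hm' := hm.replace_arr (fun _ => true) (fun i _ => h1 i) (by simp)
    exact ⟨_, .single ⟨act, _, hg, hm', rfl⟩, rfl⟩
  | succ r ih =>
    obtain ⟨act, hg⟩ := (h.safe hs).exists_good
    obtain ⟨m, hm⟩ := exists_moveOK h.valid hg.actionOK
    choose g hgs hlt y hy e using hr
    have h1 : ∀ i, decide (g i = (Z i).1.2.1 + 1) = true →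
        (Z i).1.2.1 + 1 ∈ (Υ.task i).arr.support := fun i hi => by
      rw [decide_eq_true_iff] at hi
      exact hi ▸ hgs i
    have h2 : ∀ i, decide (g i = (Z i).1.2.1 + 1) = false →
        ∃ a ∈ (Υ.task i).arr.support, (Z i).1.2.1 + 1 < a := fun i hi => by
      rw [decide_eq_false_iff_not] at hi
      have := hlt i
      exact ⟨g i, hgs i, by omega⟩
    have hm' := hm.replace_arr _ h1 h2
    have hstep : Υ.Step N Z _ := ⟨act, _, hg, hm', rfl⟩
    have hnext : ∀ i, CanArrive (Υ.task i) (nextMemo N Z act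
        (fun i => ((m i).1, decide (g i = (Z i).1.2.1 + 1))) i).1.2.1 (r + 1) := fun i => by
      have := e i
      have := hlt i
      simp only [nextMemo, Algo.update, Algo.next]
      by_cases hi : g i = (Z i).1.2.1 + 1
      · simp only [hi, decide_true, if_true]
        have hye : y i = r + 1 := by omega
        exact canArrive_zero (hye ▸ hy i) (Nat.succ_ne_zero r)
      · simp only [hi, decide_false, Bool.false_eq_true, if_false]
        exact ⟨g i, hgs i, by omega, y i, hy i, by omega⟩
    obtain ⟨Z', hp, hZ'⟩ := ih (h.step hstep) hnext
    exact ⟨Z', .head hstep hp, hZ'⟩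

/-- From every reachable memory the initial vertex can be reached again.  Task `i` will submit a
job at some time `u i`, which is a sum of inter-arrival times; by repeating these, it can submit
jobs at all multiples of `u i`, in particular at the product of all `u j`. -/
theorem Reach.exists_path_start (hs : Υ.Schedulable) (h : Υ.Reach N t Z) :
    ∃ Z', Υ.Path N Z Z' ∧ phases Z' = fun _ => (0, 0, false) := by
  rcases isEmpty_or_nonempty (Fin n) with he | ⟨⟨i₀⟩⟩
  · exact ⟨Z, .refl, funext fun i => he.elim i⟩
  choose τ hτ eτ using h.exists_last_arrival
  choose g hg hlt using fun i => (h.valid i).2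
  have hu : ∀ i, t < τ i + g i := fun i => by
    have := eτ i
    have : (Z i).1.2.1 < g i := hlt i
    omega
  have hpos : 0 < ∏ i, (τ i + g i) := Finset.prod_pos fun i _ => (Nat.zero_le t).trans_lt (hu i)
  have hle : ∀ i, t < ∏ j, (τ j + g j) := fun i =>
    (hu i).trans_le (Nat.le_of_dvd hpos (Finset.dvd_prod_of_mem _ (Finset.mem_univ i)))
  obtain ⟨r, hr⟩ := Nat.exists_eq_add_of_lt (hle i₀)
  refine h.path_start hs r fun i => ?_
  obtain ⟨k, hk⟩ := Finset.dvd_prod_of_mem (fun j => τ j + g j) (Finset.mem_univ i)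
  rw [hk] at hr
  obtain ⟨k, rfl⟩ : ∃ k', k = k' + 1 := Nat.exists_eq_succ_of_ne_zero fun h0 => by
    rw [h0, mul_zero] at hr
    omega
  refine ⟨g i, hg i, hlt i, k • (τ i + g i),
    nsmul_mem (add_mem (hτ i) (AddSubmonoid.subset_closure (hg i))) k, ?_⟩
  have := eτ i
  rw [smul_eq_mul]
  rw [mul_add, mul_one, mul_comm] at hr
  omega

/-! ### Progress of the samplers -/

/-- Vertices of the safe region can be reached from the initial vertex. -/
theorem Reach.exists_path_of_inSafeRegion {s : Config n} (hs : Υ.InSafeRegion s)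
    (h : Υ.Reach N t Z) (h0 : phases Z = fun _ => (0, 0, false)) :
    ∃ Z', Υ.Path N Z Z' ∧ Υ.conc (phases Z') = s := by
  induction hs with
  | init => exact ⟨Z, .refl, by rw [h0, conc_start]⟩
  | step s act m _ he hm ih =>
    obtain ⟨Z', hp, rfl⟩ := ih
    obtain ⟨t', h'⟩ := h.path hp
    have hg := he.good h'.valid
    have hm' := (mem_support_iff_moveOK h'.valid hg.actionOK).1 hm
    exact ⟨_, hp.tail ⟨act, m, hg, hm', rfl⟩, (resolve_conc h'.valid hm').symm⟩

/-- All vertices of a play are given by phases, and before the deadline no further job of a task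
arrives. -/
theorem IsPlay.exists_phases {σ : Config n → Option (Fin n)} (hσ : IsStrategy σ)
    {s : ℕ → Config n} {m : ℕ → Moves n} (hp : Υ.IsPlay σ s m) {X : Fin n → Phase}
    (hX : Υ.Valid X) (h0 : s 0 = Υ.conc X) (k : ℕ) :
    ∃ Y, Υ.Valid Y ∧ s k = Υ.conc Y ∧ ∀ i, (X i).2.1 = 0 → k < (Υ.task i).deadline →
      (Y i).2.1 = k := by
  induction k with
  | zero => exact ⟨X, hX, h0, fun i hi _ => hi⟩
  | succ k ih =>
    obtain ⟨Y, hY, e, hb⟩ := ih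
    have ha : Υ.ActionOK Y (σ (s k)) := by
      rw [← allowed_conc_iff hY, ← e]
      exact hσ _
    obtain ⟨hm, hk⟩ := hp k
    rw [e] at hm
    rw [e] at ha
    have hm' := (mem_support_iff_moveOK hY ha).1 hm
    refine ⟨_, valid_nextPhases hY ha hm', ?_, fun i hi hlt => ?_⟩
    · rw [hk, e, resolve_conc hY hm']
    · have := hb i hi (by omega)
      cases hmi : (m k i).2
      · simp [nextPhases, Algo.next, hmi, this]
      · have := (Υ.task i).le_arr _ ((moveOK_arr hm' i).1 hmi)
        omega

/-- Under a safe strategy, every job of a hard task is completed by its deadline. -/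
theorem SafeFrom.exists_complete {σ : Config n → Option (Fin n)} {s₀ : Config n}
    (hσ : Υ.SafeFrom σ s₀) {X : Fin n → Phase} (hX : Υ.Valid X) (h0 : s₀ = Υ.conc X)
    {i : Fin n} (hi : i ∈ Υ.hard) (hb : (X i).2.1 = 0) {s : ℕ → Config n} {m : ℕ → Moves n}
    (hp : Υ.IsPlay σ s m) (hs : s 0 = s₀) : ∃ k < (Υ.task i).deadline, (m k i).1 = true := by
  have hD := (Υ.task i).deadline_pos
  refine ⟨(Υ.task i).deadline - 1, by omega, ?_⟩
  obtain ⟨Y, -, e, hY⟩ := hp.exists_phases hσ.1 hX (hs.trans h0) ((Υ.task i).deadline - 1)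
  by_contra hm
  have := hY i hb (by omega)
  refine hσ.2 s m hp hs ((Υ.task i).deadline - 1) ?_
  rw [e, hardMiss_iff]
  exact ⟨i, (miss_iff i).2 ⟨hi, by omega, by simpa using hm⟩⟩

/-- If a strategy makes safe choices and guarantees that the job of task `i` that has just arrived
is completed by its deadline, then the sampler for the computation time of the task can make
progress: when the job takes the longest possible computation time, it passes all levels. -/
theorem Reach.exists_progress {σ : Config n → Option (Fin n)}
    (h : Υ.Reach N t Z) {i : Fin n} (hf : Υ.conc (phases Z) i = Υ.fresh i)
    (hN : (Z i).2.1.2.length < N)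
    (hsafe : ∀ s m, Υ.IsPlay σ s m → s 0 = Υ.conc (phases Z) → ∀ k, Υ.SafeEdge (s k) (σ (s k)))
    (hc : ∀ s m, Υ.IsPlay σ s m → s 0 = Υ.conc (phases Z) →
      ∃ k < (Υ.task i).deadline, (m k i).1 = true) :
    ∃ Z', Υ.Path N Z Z' ∧ used Z < used Z' := by
  classical
  -- The generator avoids the completion of the job whenever it can.
  have hpick : ∀ s, ∃ m ∈ (genMove (tick s (σ s))).support,
      (m i).1 = true → ∀ m' ∈ (genMove (tick s (σ s))).support, (m' i).1 = true := fun s => by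
    by_cases hex : ∃ m ∈ (genMove (tick s (σ s))).support, (m i).1 = false
    · obtain ⟨m, hm, hf⟩ := hex
      exact ⟨m, hm, fun ht => by simp [hf] at ht⟩
    · push Not at hex
      obtain ⟨m, hm⟩ := (genMove (tick s (σ s))).support_nonempty
      exact ⟨m, hm, fun _ m' hm' => by simpa using hex m' hm'⟩
  choose pick hpick hforced using hpick
  obtain ⟨s, hp, h0⟩ := exists_isPlay (Υ := Υ) σ pick hpick (Υ.conc (phases Z))
  have hedge := hsafe _ _ hp h0
  have hex := hc _ _ hp h0
  obtain ⟨hkD, hkt⟩ := Nat.find_spec hex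
  set K := Nat.find hex with hK
  have hmin : ∀ j < K, (pick (s j) i).1 = false := fun j hj => by
    have := Nat.find_min hex hj
    push Not at this
    simpa using this (by omega)
  -- The new job is in its initial phase.
  have hphase : (Z i).1 = (0, 0, false) := by
    have hd : (Υ.task i).deadline - (Z i).1.2.1 = (Υ.task i).deadline :=
      congrArg JobState.d hf
    have hcc : (if (Z i).1.2.2 then PMF.pure 0 else resid (Υ.task i).comp (Z i).1.1) =
      (Υ.task i).comp := congrArg JobState.c hf
    have hle := (h.memoOK i).le
    have hD := (Υ.task i).deadline_pos
    have hb : (Z i).1.2.1 = 0 := by omega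
    have hdone : (Z i).1.2.2 = false := by
      by_contra hdone
      rw [if_pos (by simpa using hdone)] at hcc
      have := (Υ.task i).comp_zero
      rw [← hcc] at this
      simp at this
    exact Prod.ext (by simp only; omega) (Prod.ext hb hdone)
  -- Up to time `K`, the sampler waits at a level that the job has not passed.
  have key : ∀ k ≤ K, (∃ Z', Υ.Path N Z Z' ∧ used Z < used Z') ∨
      ∃ Z', Υ.Path N Z Z' ∧ Υ.conc (phases Z') = s k ∧ (Z' i).1.2.2 = false ∧
        (Z' i).1.2.1 = k ∧ (Z' i).2.1 = (Z i).2.1 ∧ (Z' i).1.1 ≤ (Z i).2.1.1 := by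
    intro k hk
    induction k with
    | zero => exact Or.inr ⟨Z, .refl, h0.symm, by simp [hphase]⟩
    | succ k ih =>
      rcases ih (by omega) with ih | ⟨Z', hpath, e, hd, hb, hq, hle⟩
      · exact Or.inl ih
      obtain ⟨t', h'⟩ := h.path hpath
      have hg : Υ.Good (phases Z') (σ (s k)) := SafeEdge.good h'.valid (e ▸ hedge k)
      have hm : Υ.MoveOK (phases Z') (σ (s k)) (pick (s k)) := by
        rw [← mem_support_iff_moveOK h'.valid hg.actionOK, e]
        exact (hp k).1
      have hpath' := hpath.tail ⟨_, _, hg, hm, rfl⟩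
      have hmk := hmin k (by omega)
      by_cases htr : σ (s k) = some i ∧ (Z' i).1.1 = (Z' i).2.1.1
      · refine Or.inl ⟨_, hpath', (used_le_path hpath).trans_lt (used_lt_nextMemo i (Or.inl ?_))⟩
        exact ⟨htr.1, htr.2, by rw [hq]; exact hN⟩
      · have ham : (pick (s k) i).2 = false := by
          by_contra ham
          have : _ ≤ (Z' i).1.2.1 + 1 :=
            (Υ.task i).le_arr _ ((moveOK_arr hm i).1 (by simpa using ham))
          omega
        refine Or.inr ⟨_, hpath', ?_, ?_, ?_, ?_, ?_⟩
        · have hres := resolve_conc h'.valid hm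
          rw [e] at hres
          exact hres.symm.trans (hp k).2.symm
        · simp [nextMemo, Algo.update, Algo.next, ham, hmk]
        · simp [nextMemo, Algo.update, Algo.next, ham, hb]
        · rw [← hq]
          refine Algo.sample_of_not fun hn => htr ⟨by simpa using hn.1, hn.2.1⟩
        · simp only [nextMemo, Algo.update, Algo.next, ham, Bool.false_eq_true, if_false]
          split_ifs with hi
          · rw [decide_eq_true_iff] at hi
            have : (Z' i).1.1 ≠ (Z' i).2.1.1 := fun hn => htr ⟨hi, hn⟩
            rw [hq] at this
            omega
          · exact hle
  rcases key K le_rfl with hdone | ⟨Z', hpath, e, hd, hb, hq, hle⟩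
  · exact hdone
  obtain ⟨t', h'⟩ := h.path hpath
  have hg : Υ.Good (phases Z') (σ (s K)) := SafeEdge.good h'.valid (e ▸ hedge K)
  have hm : Υ.MoveOK (phases Z') (σ (s K)) (pick (s K)) := by
    rw [← mem_support_iff_moveOK h'.valid hg.actionOK, e]
    exact (hp K).1
  obtain ⟨c1, c2, c3, c4⟩ := moveOK_comp hm i
  have hi : σ (s K) = some i := by
    by_contra hi
    rw [c2 hd hi] at hkt
    simp at hkt
  -- Completion was forced, so that the job has just passed the last level.
  have hlast : ∀ c ∈ (Υ.task i).comp.support, c ≤ (Z' i).1.1 + 1 := by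
    by_contra hlast
    push Not at hlast
    obtain ⟨c, hcs, hlt⟩ := hlast
    have hm' : Υ.MoveOK (phases Z') (σ (s K))
        (Function.update (pick (s K)) i (false, (pick (s K) i).2)) := fun j => by
      by_cases hj : j = i
      · subst hj
        have h2 := (Bool.and_eq_true _ _ ▸ hm j : _ ∧ _).2
        rw [Function.update_self]
        refine (Bool.and_eq_true _ _).symm ▸ ⟨?_, h2⟩
        simp only [hd, hi, Bool.false_eq_true, if_false, decide_true, if_true, List.any_eq_true,
          decide_eq_true_eq, mem_entry_comp]
        exact ⟨c, hcs, hlt⟩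
      · rw [Function.update_of_ne hj]
        exact hm j
    rw [← mem_support_iff_moveOK h'.valid hg.actionOK, e] at hm'
    have := hforced (s K) hkt _ hm'
    simp at this
  obtain ⟨⟨c, hcs, hlt⟩, -⟩ := (h'.memoOK i).comp
  have := hlast c hcs
  refine ⟨_, hpath.tail ⟨_, _, hg, hm, rfl⟩,
    (used_le_path hpath).trans_lt (used_lt_nextMemo i (Or.inl ⟨hi, ?_, by rw [hq]; exact hN⟩))⟩
  rw [hq] at hlt ⊢
  omega

/-- All samplers are full. -/
def Full (N : ℕ) (Z : Fin n → Algo.Memo) : Prop :=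
  ∀ i, N ≤ (Z i).2.1.2.length ∧ N ≤ (Z i).2.2.2.length

theorem full_ofFn : Algo.full N (List.ofFn Z) = true ↔ Full N Z := by
  simp [Algo.full, Full, List.mem_ofFn]

theorem IsPlay.inSafeRegion {σ : Config n → Option (Fin n)} {s : ℕ → Config n}
    {m : ℕ → Moves n} (hp : Υ.IsPlay σ s m) (h0 : Υ.InSafeRegion (s 0))
    (hσ : ∀ s, Υ.InSafeRegion s → Υ.SafeEdge s (σ s)) (k : ℕ) : Υ.InSafeRegion (s k) := by
  induction k with
  | zero => exact h0
  | succ k ih =>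
    rw [(hp k).2]
    exact .step _ _ _ ih (hσ _ ih) (hp k).1

theorem IsPlay.safeFrom {σ : Config n → Option (Fin n)} {s : ℕ → Config n}
    {m : ℕ → Moves n} (hp : Υ.IsPlay σ s m) (h0 : Υ.SafeFrom σ (s 0)) (k : ℕ) :
    Υ.SafeFrom σ (s k) := by
  induction k with
  | zero => exact h0
  | succ k ih =>
    rw [(hp k).2]
    exact ih.resolve (hp k).1

theorem Reach.exists_used_lt (hs : Υ.Schedulable) (hgood : Υ.GoodForSampling)
    (h : Υ.Reach N t Z) (hfull : ¬ Full N Z) : ∃ Z', Υ.Path N Z Z' ∧ used Z < used Z' := by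
  unfold Full at hfull
  push Not at hfull
  obtain ⟨i, hi⟩ := hfull
  by_cases hN : (Z i).2.2.2.length < N
  · obtain ⟨act, hg⟩ := (h.safe hs).exists_good
    obtain ⟨m, hm⟩ := exists_moveOK h.valid hg.actionOK
    exact ⟨_, .single ⟨act, m, hg, hm, rfl⟩,
      used_lt_nextMemo i (Or.inr ⟨((h.memoOK i).level hN).symm, hN⟩)⟩
  · have hN' : (Z i).2.1.2.length < N := by
      by_contra hN'
      exact hN (hi (by omega))
    obtain ⟨Z₁, hp₁, h₁⟩ := h.exists_path_start hs
    obtain ⟨t₁, hr₁⟩ := h.path hp₁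
    -- a vertex and a strategy that guarantee the completion of a new job of the task
    obtain ⟨v, hv, hvi, σ, hsafe, hc⟩ : ∃ v, Υ.InSafeRegion v ∧ v i = Υ.fresh i ∧ ∃ σ,
          (∀ s m, Υ.IsPlay σ s m → s 0 = v → ∀ k, Υ.SafeEdge (s k) (σ (s k))) ∧
          ∀ s m, Υ.IsPlay σ s m → s 0 = v → ∃ k < (Υ.task i).deadline, (m k i).1 = true := by
      by_cases hh : i ∈ Υ.hard
      · obtain ⟨σ, hσ⟩ := hs
        refine ⟨Υ.init, .init, rfl, σ, fun s m hp h0 k => ?_, fun s m hp h0 => ?_⟩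
        · exact ⟨σ, hp.safeFrom (h0 ▸ hσ) k, rfl⟩
        · exact hσ.exists_complete Υ.valid_start rfl hh rfl hp h0
      · obtain ⟨v, hv, hvi, σ, -, h1, h2⟩ := hgood i hh
        exact ⟨v, hv, hvi, σ, fun s m hp h0 k => h1 _ (hp.inSafeRegion (h0 ▸ hv) h1 k), h2⟩
    obtain ⟨Z₂, hp₂, rfl⟩ := hr₁.exists_path_of_inSafeRegion hv h₁
    have hp := hp₁.trans hp₂
    obtain ⟨t₂, hr₂⟩ := hr₁.path hp₂
    rcases used_lt_or_eq_path hp i with hlt | he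
    · exact ⟨Z₂, hp, hlt⟩
    · obtain ⟨Z₃, hp₃, hlt⟩ := hr₂.exists_progress hvi (he ▸ hN') hsafe hc
      exact ⟨Z₃, hp.trans hp₃, (used_le_path hp).trans_lt hlt⟩

end TaskSystem

/-! ### Expectations -/

/-- Expectation of a nonnegative function. -/
noncomputable def expect {α : Type*} (p : PMF α) (g : α → ℝ≥0∞) : ℝ≥0∞ := ∑' a, p a * g a

section Expect

variable {α β : Type*} {p : PMF α} {g g' : α → ℝ≥0∞}

theorem expect_pure (a : α) (g : α → ℝ≥0∞) : expect (PMF.pure a) g = g a := by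
  unfold expect
  rw [tsum_eq_single a]
  · simp
  · intro b hb
    simp [hb]

theorem expect_bind (p : PMF α) (f : α → PMF β) (g : β → ℝ≥0∞) :
    expect (p.bind f) g = expect p fun a => expect (f a) g := by
  unfold expect
  simp only [PMF.bind_apply, ← ENNReal.tsum_mul_right, ← ENNReal.tsum_mul_left]
  rw [ENNReal.tsum_comm]
  simp only [mul_assoc]

theorem expect_map (p : PMF α) (f : α → β) (g : β → ℝ≥0∞) :
    expect (p.map f) g = expect p fun a => g (f a) := by
  rw [← PMF.bind_pure_comp, expect_bind]
  simp [expect_pure]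

theorem expect_mono (h : ∀ a ∈ p.support, g a ≤ g' a) : expect p g ≤ expect p g' := by
  refine ENNReal.tsum_le_tsum fun a => ?_
  by_cases ha : p a = 0
  · simp [ha]
  · gcongr
    exact h a ha

theorem expect_congr (h : ∀ a ∈ p.support, g a = g' a) : expect p g = expect p g' :=
  le_antisymm (expect_mono fun a ha => (h a ha).le) (expect_mono fun a ha => (h a ha).ge)

theorem expect_const (p : PMF α) (c : ℝ≥0∞) : (expect p fun _ => c) = c := by
  unfold expect
  rw [ENNReal.tsum_mul_right, p.tsum_coe, one_mul]

theorem toOuterMeasure_eq_expect (p : PMF α) (s : Set α) :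
    p.toOuterMeasure s = expect p (s.indicator 1) := by
  rw [PMF.toOuterMeasure_apply]
  refine tsum_congr fun a => ?_
  by_cases ha : a ∈ s <;> simp [ha]

/-- Markov's inequality. -/
theorem toOuterMeasure_mul_le {s : Set α} {c : ℝ≥0∞} (h : ∀ a ∈ p.support, a ∈ s → c ≤ g a) :
    p.toOuterMeasure s * c ≤ expect p g := by
  rw [toOuterMeasure_eq_expect]
  unfold expect
  rw [← ENNReal.tsum_mul_right]
  refine ENNReal.tsum_le_tsum fun a => ?_
  by_cases ha : a ∈ s
  · by_cases hp : p a = 0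
    · simp [hp]
    · simp only [Set.indicator_of_mem ha, Pi.one_apply, mul_one]
      gcongr
      exact h a hp ha
  · simp [ha]

/-- Monotone convergence. -/
theorem expect_iSup {f : ℕ → α → ℝ≥0∞} (h : ∀ a ∈ p.support, Monotone fun t => f t a) :
    (expect p fun a => ⨆ t, f t a) = ⨆ t, expect p (f t) := by
  unfold expect
  simp only [ENNReal.mul_iSup, ENNReal.tsum_eq_iSup_sum]
  rw [iSup_comm]
  refine iSup_congr fun s => ENNReal.finsetSum_iSup_of_monotone fun a t t' htt' => ?_
  by_cases ha : p a = 0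
  · simp [ha]
  · gcongr
    exact h a ha htt'

theorem mem_support_drawFrom {l : List (Option ℕ)} (hl : l ≠ []) {r : Option ℕ} :
    r ∈ (drawFrom l).support ↔ r ∈ l := by
  unfold drawFrom
  rw [dif_neg (by simpa using hl), PMF.mem_support_ofMultiset_iff]
  simp

end Expect

/-! ### The execution under the control of the learner -/

namespace TaskSystem

variable {n : ℕ} {Υ : TaskSystem n} {N t : ℕ} {Z Z' : Fin n → Algo.Memo} {ε γ : ℚ}

/-- The number of samples that the learner collects for each law. -/
noncomputable def size (Υ : TaskSystem n) (ε γ : ℚ) : ℕ :=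
  Algo.sampleSize Υ.structCode (ε.num.toNat, ε.den) (γ.num.toNat, γ.den)

/-- The actions between which the learner draws. -/
noncomputable def replies (Υ : TaskSystem n) (Z : Fin n → Algo.Memo) : List (Option ℕ) :=
  Algo.actions Υ.structCode (Algo.safeSet Υ.structCode) (List.ofFn (phases Z))

theorem reply_learner (h : History n) :
    Υ.reply Algo.learner ε γ h = Algo.answer Υ.structCode (Υ.size ε γ)
      (List.ofFn (memoryOf (Υ.size ε γ) h)) := by
  have hl : Υ.structCode.length = n := by rw [structCode_eq, List.length_ofFn]
  have hr : Υ.reply Algo.learner ε γ h = Algo.answer Υ.structCode (Υ.size ε γ)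
    (Algo.memory (Υ.size ε γ) Υ.structCode.length h.observation) := rfl
  rw [hr, hl, memory_observation]

theorem reply_learner_fst (h : History n) :
    (Υ.reply Algo.learner ε γ h).1 = Υ.replies (memoryOf (Υ.size ε γ) h) := by
  rw [reply_learner, Algo.answer, List.map_ofFn]
  rfl

theorem mem_replies {r : Option ℕ} :
    r ∈ Υ.replies Z ↔ ∃ act : Option (Fin n), r = act.map Fin.val ∧ Υ.Good (phases Z) act :=
  mem_actions_iff _ _

/-- The law of the memory after the next tick. -/
noncomputable def kernel (Υ : TaskSystem n) (N : ℕ) (Z : Fin n → Algo.Memo) :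
    PMF (Fin n → Algo.Memo) :=
  (drawFrom (Υ.replies Z)).bind fun r =>
    (genMove (tick (Υ.conc (phases Z)) (effective (Υ.conc (phases Z)) r))).map fun m =>
      nextMemo N Z (effective (Υ.conc (phases Z)) r) m

theorem Reach.mem_support_drawFrom (hs : Υ.Schedulable) (h : Υ.Reach N t Z) {r : Option ℕ} :
    r ∈ (drawFrom (Υ.replies Z)).support ↔
      ∃ act : Option (Fin n), r = act.map Fin.val ∧ Υ.Good (phases Z) act := by
  rw [TaskLearning.mem_support_drawFrom, mem_replies]
  obtain ⟨act, ha⟩ := (h.safe hs).exists_good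
  exact List.ne_nil_of_mem (mem_replies.2 ⟨act, rfl, ha⟩)

theorem Reach.mem_support_kernel (hs : Υ.Schedulable) (h : Υ.Reach N t Z) :
    Z' ∈ (Υ.kernel N Z).support ↔ Υ.Step N Z Z' := by
  unfold kernel Step
  simp only [PMF.mem_support_bind_iff, PMF.mem_support_map_iff, h.mem_support_drawFrom hs]
  constructor
  · rintro ⟨_, ⟨act, rfl, ha⟩, m, hm, rfl⟩
    rw [effective_conc h.valid ha.actionOK] at hm ⊢
    exact ⟨act, m, ha, (mem_support_iff_moveOK h.valid ha.actionOK).1 hm, rfl⟩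
  · rintro ⟨act, m, ha, hm, rfl⟩
    refine ⟨_, ⟨act, rfl, ha⟩, m, ?_⟩
    rw [effective_conc h.valid ha.actionOK]
    exact ⟨(mem_support_iff_moveOK h.valid ha.actionOK).2 hm, rfl⟩

/-- Along every execution, the memory is reachable and determines the vertex, and no hard task
has missed a deadline. -/
theorem run_spec (hs : Υ.Schedulable) {h : History n}
    (hh : h ∈ (Υ.run Algo.learner ε γ t).support) :
    Υ.Reach (Υ.size ε γ) t (memoryOf (Υ.size ε γ) h) ∧
      Υ.configAt h = Υ.conc (phases (memoryOf (Υ.size ε γ) h)) ∧ ¬ Υ.Missed h := by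
  induction t generalizing h with
  | zero =>
    rw [run, PMF.mem_support_pure_iff] at hh
    subst hh
    exact ⟨.zero, rfl, id⟩
  | succ t ih =>
    rw [run] at hh
    simp only [PMF.mem_support_bind_iff, PMF.mem_support_map_iff, reply_learner_fst] at hh
    obtain ⟨h', hh', r, hr, m, hm, rfl⟩ := hh
    obtain ⟨hR, hC, hM⟩ := ih hh'
    obtain ⟨act, rfl, ha⟩ := (hR.mem_support_drawFrom hs).1 hr
    rw [hC, effective_conc hR.valid ha.actionOK] at hm ⊢
    have hm' := (mem_support_iff_moveOK hR.valid ha.actionOK).1 hm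
    refine ⟨hR.succ ha hm', ?_, ?_⟩
    · rw [configAt, hC]
      exact resolve_conc hR.valid hm'
    · rintro (hM' | hM')
      · rw [hC, hardMiss_iff] at hM'
        obtain ⟨i, hi⟩ := hM'
        exact ha.not_miss hm' i hi
      · exact hM hM'

/-- The memory is a Markov chain. -/
theorem expect_run_succ (hs : Υ.Schedulable) (g : (Fin n → Algo.Memo) → ℝ≥0∞) :
    (expect (Υ.run Algo.learner ε γ (t + 1)) fun h => g (memoryOf (Υ.size ε γ) h)) =
      expect (Υ.run Algo.learner ε γ t) fun h =>
        expect (Υ.kernel (Υ.size ε γ) (memoryOf (Υ.size ε γ) h)) g := by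
  rw [run, expect_bind]
  refine expect_congr fun h hh => ?_
  rw [kernel, expect_bind, expect_bind, reply_learner_fst, (run_spec hs hh).2.1]
  refine expect_congr fun r _ => ?_
  rw [expect_map, expect_map]
  rfl

theorem Full.nextMemo_snd (h : Full N Z) (act : Option (Fin n)) (m : Moves n) (i : Fin n) :
    (nextMemo N Z act m i).2 = (Z i).2 :=
  Prod.ext (Algo.sample_of_not fun hn => absurd hn.2.2 (not_lt.2 (h i).1))
    (Algo.sample_of_not fun hn => absurd hn.2.2 (not_lt.2 (h i).2))

theorem Full.nextMemo (h : Full N Z) (act : Option (Fin n)) (m : Moves n) :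
    Full N (nextMemo N Z act m) := fun i => by
  rw [h.nextMemo_snd]
  exact h i

/-- The model that the learner outputs when its memory is `Z`. -/
noncomputable def modelOf (Υ : TaskSystem n) (Z : Fin n → Algo.Memo) : ModelCode :=
  List.ofFn fun i => (decide (i ∈ Υ.hard),
    ((Υ.entry i).2.1 ++ (Z i).2.1.2).map (fun a => (a, 1)), (Υ.task i).deadline,
    ((Υ.entry i).2.2.2 ++ (Z i).2.2.2).map (fun a => (a, 1)))

theorem model_ofFn : Algo.model Υ.structCode (List.ofFn Z) = Υ.modelOf Z := by
  unfold Algo.model modelOf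
  rw [structCode_eq, List.length_ofFn, Algo.map_range_eq_ofFn]
  congr 1
  funext i
  rw [Algo.getD_ofFn, Algo.getD_ofFn]
  rfl

open Classical in
/-- As full samplers never change, the output is determined by the current memory. -/
theorem output_learner (h : History n) :
    Υ.output Algo.learner ε γ h = if Full (Υ.size ε γ) (memoryOf (Υ.size ε γ) h) then
      some (Υ.modelOf (memoryOf (Υ.size ε γ) h)) else none := by
  have hr : ∀ h, (Υ.reply Algo.learner ε γ h).2 =
      if Full (Υ.size ε γ) (memoryOf (Υ.size ε γ) h) then
        some (Υ.modelOf (memoryOf (Υ.size ε γ) h)) else none := fun h => by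
    rw [reply_learner, Algo.answer, model_ofFn]
    exact if_congr full_ofFn rfl rfl
  induction h with
  | nil => exact hr _
  | cons x h ih =>
    rw [output, ih, hr]
    by_cases hf : Full (Υ.size ε γ) (memoryOf (Υ.size ε γ) h)
    · have hf' : Full (Υ.size ε γ) (memoryOf (Υ.size ε γ) (x :: h)) := hf.nextMemo _ _
      rw [if_pos hf, if_pos hf', Option.some_or]
      congr 1
      unfold modelOf
      congr 1
      funext i
      have : memoryOf (Υ.size ε γ) (x :: h) i = nextMemo (Υ.size ε γ)
        (memoryOf (Υ.size ε γ) h) x.1 x.2 i := rfl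
      rw [this, hf.nextMemo_snd]
    · rw [if_neg hf, Option.none_or]

/-! ### Termination -/

theorem finite_sampler (N K : ℕ) :
    {q : Sampler | q.1 < K ∧ q.2.length ≤ N ∧ ∀ x ∈ q.2, x < K}.Finite := by
  have h : {l : List ℕ | l.length ≤ N ∧ ∀ x ∈ l, x < K}.Finite := by
    refine ((List.finite_length_le (Fin K) N).image (List.map Fin.val)).subset ?_
    rintro l ⟨hl, hK⟩
    lift l to List (Fin K) using hK
    exact ⟨l, by simpa using hl, rfl⟩
  exact ((Set.finite_Iio K).prod h).subset fun q hq => ⟨hq.1, hq.2⟩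

theorem Sampler.OK.mem {S : Set ℕ} {K : ℕ} (hS : ∀ c ∈ S, c < K) {q : Sampler}
    (h : q.OK N S) : q ∈ {q : Sampler | q.1 < K ∧ q.2.length ≤ N ∧ ∀ x ∈ q.2, x < K} := by
  obtain ⟨⟨c, hc, hlt⟩, hs, hl, -⟩ := h
  exact ⟨hlt.trans (hS c hc), hl, fun x hx => hS x (hs x hx)⟩

theorem finite_reach (Υ : TaskSystem n) (N : ℕ) : {Z | ∃ t, Υ.Reach N t Z}.Finite := by
  set K := Algo.bound Υ.structCode
  have hS := finite_sampler N K
  have hP : ((Set.Iio K ×ˢ Set.Iio K ×ˢ Set.univ : Set Phase)).Finite :=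
    (Set.finite_Iio K).prod ((Set.finite_Iio K).prod Set.finite_univ)
  refine (Set.Finite.pi fun _ : Fin n => hP.prod (hS.prod hS)).subset ?_
  rintro Z ⟨t, h⟩ i -
  obtain ⟨⟨⟨c, hc, hle, -⟩, a, ha, hlt⟩, -, h1, h2, -⟩ := h.memoOK i
  refine ⟨⟨?_, ?_, Set.mem_univ _⟩, Sampler.OK.mem (fun c hc => comp_lt_bound hc) h1,
    Sampler.OK.mem (fun c hc => arr_lt_bound hc) h2⟩
  · exact hle.trans_lt (comp_lt_bound hc)
  · exact hlt.trans (arr_lt_bound ha)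

/-- From every reachable memory the learner can get to a full one. -/
theorem Reach.exists_full (hs : Υ.Schedulable) (hg : Υ.GoodForSampling) (h : Υ.Reach N t Z) :
    ∃ Z', Υ.Path N Z Z' ∧ Full N Z' := by
  obtain ⟨B, hB⟩ := ((finite_reach Υ N).image used).bddAbove
  have hB' : ∀ {t Z}, Υ.Reach N t Z → used Z ≤ B := fun h => hB ⟨_, ⟨_, h⟩, rfl⟩
  induction hk : B - used Z using Nat.strong_induction_on generalizing t Z with
  | _ k ih =>
    by_cases hf : Full N Z
    · exact ⟨Z, .refl, hf⟩
    · obtain ⟨Z₁, hp, hlt⟩ := h.exists_used_lt hs hg hf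
      obtain ⟨t₁, h₁⟩ := h.path hp
      have := hB' h₁
      obtain ⟨Z₂, hp₂, hf₂⟩ := ih (B - used Z₁) (by omega) h₁ rfl
      exact ⟨Z₂, hp.trans hp₂, hf₂⟩

open Classical in
/-- The probability that all samplers are full after `t` more ticks. -/
noncomputable def probFull (Υ : TaskSystem n) (N : ℕ) : ℕ → (Fin n → Algo.Memo) → ℝ≥0∞
  | 0, Z => if Full N Z then 1 else 0
  | t + 1, Z => expect (Υ.kernel N Z) (probFull Υ N t)

theorem probFull_le_one (s : ℕ) (Z : Fin n → Algo.Memo) : Υ.probFull N s Z ≤ 1 := by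
  induction s generalizing Z with
  | zero =>
    rw [probFull]
    split_ifs <;> simp
  | succ s ih =>
    rw [probFull]
    exact (expect_mono fun Z _ => ih Z).trans (expect_const _ 1).le

theorem Reach.probFull_le_succ (hs : Υ.Schedulable) (h : Υ.Reach N t Z) (s : ℕ) :
    Υ.probFull N s Z ≤ Υ.probFull N (s + 1) Z := by
  induction s generalizing t Z with
  | zero =>
    by_cases hf : Full N Z
    · rw [probFull, probFull, if_pos hf, ← expect_const (Υ.kernel N Z) 1]
      refine expect_mono fun Z' hZ' => ?_
      obtain ⟨act, m, -, -, rfl⟩ := (h.mem_support_kernel hs).1 hZ'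
      rw [probFull, if_pos (hf.nextMemo act m)]
    · rw [probFull, if_neg hf]
      exact zero_le
  | succ s ih =>
    rw [probFull, probFull]
    exact expect_mono fun Z' hZ' => ih (h.step ((h.mem_support_kernel hs).1 hZ'))

/-- All samplers get full with probability one.  Otherwise consider a reachable memory for which
this probability is minimal.  The probability is the mean of the probabilities for the successors,
so that it is the same for all of them, and hence along every path, although some path leads to
a full memory. -/
theorem iSup_probFull (hs : Υ.Schedulable) (hg : Υ.GoodForSampling) :
    ⨆ s, Υ.probFull N s (fun _ => Algo.start) = 1 := by
  set U : (Fin n → Algo.Memo) → ℝ≥0∞ := fun Z => ⨆ s, Υ.probFull N s Z with hU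
  have hle : ∀ Z, U Z ≤ 1 := fun Z => iSup_le fun s => probFull_le_one s Z
  have hharm : ∀ {t Z}, Υ.Reach N t Z → expect (Υ.kernel N Z) U ≤ U Z := fun {t Z} h => by
    rw [hU, expect_iSup fun Z' hZ' => monotone_nat_of_le_succ fun s =>
      (h.step ((h.mem_support_kernel hs).1 hZ')).probFull_le_succ hs s]
    exact iSup_le fun s => le_iSup (fun s => Υ.probFull N s Z) (s + 1)
  obtain ⟨Z₀, ⟨t₀, h₀⟩, hmin⟩ := (finite_reach Υ N).exists_minimalFor U _ ⟨_, 0, .zero⟩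
  have hmin' : ∀ {t Z}, Υ.Reach N t Z → U Z₀ ≤ U Z := fun {t Z} h => by
    rcases le_total (U Z₀) (U Z) with h' | h'
    · exact h'
    · exact hmin ⟨t, h⟩ h'
  have hpath : ∀ Z, Υ.Path N Z₀ Z → U Z = U Z₀ := fun Z hp => by
    induction hp with
    | refl => rfl
    | @tail Z₁ Z₂ hp hstep ih =>
      obtain ⟨t₁, h₁⟩ := h₀.path hp
      by_contra hne
      have hlt : U Z₀ < U Z₂ := lt_of_le_of_ne (hmin' (h₁.step hstep)) (Ne.symm hne)
      have hZ₂ := (h₁.mem_support_kernel hs).2 hstep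
      have hsum : U Z₀ < expect (Υ.kernel N Z₁) U := by
        rw [← expect_const (Υ.kernel N Z₁) (U Z₀)]
        refine ENNReal.tsum_lt_tsum (i := Z₂) ?_ (fun Z => ?_) ?_
        · change expect (Υ.kernel N Z₁) (fun _ => U Z₀) ≠ ⊤
          rw [expect_const]
          exact ne_top_of_le_ne_top ENNReal.one_ne_top (hle Z₀)
        · by_cases hZ : Υ.kernel N Z₁ Z = 0
          · simp [hZ]
          · gcongr
            exact hmin' (h₁.step ((h₁.mem_support_kernel hs).1 hZ))
        · exact (ENNReal.mul_lt_mul_iff_right hZ₂ ((Υ.kernel N Z₁).apply_ne_top Z₂)).2 hlt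
      exact absurd (hsum.trans_le (hharm h₁)) (by rw [ih]; exact lt_irrefl _)
  obtain ⟨Z₁, hp, hf⟩ := h₀.exists_full hs hg
  have h1 : 1 ≤ U Z₁ := by
    refine le_trans ?_ (le_iSup (fun s => Υ.probFull N s Z₁) 0)
    rw [probFull, if_pos hf]
  rw [hpath Z₁ hp] at h1
  exact le_antisymm (hle _) (h1.trans (hmin' .zero))

theorem expect_run_probFull (hs : Υ.Schedulable) (s : ℕ) :
    (expect (Υ.run Algo.learner ε γ t) fun h =>
      Υ.probFull (Υ.size ε γ) s (memoryOf (Υ.size ε γ) h)) =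
      Υ.probFull (Υ.size ε γ) (t + s) fun _ => Algo.start := by
  induction t generalizing s with
  | zero =>
    rw [run, expect_pure, Nat.zero_add]
    rfl
  | succ t ih =>
    rw [expect_run_succ hs, Nat.succ_add_eq_add_succ, ← ih]
    rfl

theorem toOuterMeasure_full (hs : Υ.Schedulable) (t : ℕ) :
    (Υ.run Algo.learner ε γ t).toOuterMeasure {h | Full (Υ.size ε γ) (memoryOf (Υ.size ε γ) h)} =
      Υ.probFull (Υ.size ε γ) t fun _ => Algo.start := by
  classical
  rw [← Nat.add_zero t, ← expect_run_probFull hs, toOuterMeasure_eq_expect, Nat.add_zero]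
  refine expect_congr fun h _ => ?_
  rw [probFull, Set.indicator_apply]
  rfl

end TaskSystem

/-! ### Deviation of the samplers -/

section Sampler

variable {p : PMF ℕ} {N K : ℕ} {q : Sampler}

/-- The probability of the value `a` for a sample that is known to be greater than `v`. -/
noncomputable def tailProb (p : PMF ℕ) (a v : ℕ) : ℝ :=
  if v < a then (resid p v (a - v)).toReal else 0

/-- The expected number of samples with value `a` after completion of the present sample, given
the observations so far, minus its mean. -/
noncomputable def deviation (p : PMF ℕ) (a : ℕ) (q : Sampler) : ℝ :=
  q.2.count a + tailProb p a q.1 - (q.2.length + 1) * (p a).toReal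

theorem toReal_apply_le_one (p : PMF ℕ) (a : ℕ) : (p a).toReal ≤ 1 :=
  ENNReal.toReal_le_of_le_ofReal zero_le_one (by simpa using p.coe_le_one a)

theorem tailProb_mem (p : PMF ℕ) (a v : ℕ) : 0 ≤ tailProb p a v ∧ tailProb p a v ≤ 1 := by
  unfold tailProb
  split_ifs
  · exact ⟨ENNReal.toReal_nonneg, toReal_apply_le_one _ _⟩
  · exact ⟨le_rfl, zero_le_one⟩

theorem tailProb_zero (h0 : p 0 = 0) (a : ℕ) : tailProb p a 0 = (p a).toReal := by
  unfold tailProb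
  split_ifs with h
  · rfl
  · obtain rfl : a = 0 := by omega
    simp [h0]

/-- The law of total probability for the next observation of a sampler at level `v`. -/
theorem tailProb_eq (h0 : p 0 = 0) {v : ℕ} (hv : ∃ c ∈ p.support, v < c) (a : ℕ) :
    (resid p v 1).toReal * (if v + 1 = a then 1 else 0) +
      (1 - (resid p v 1).toReal) * tailProb p a (v + 1) = tailProb p a v := by
  rcases lt_trichotomy a (v + 1) with ha | rfl | ha
  · have h1 : ¬ v < a := by omega
    have h2 : ¬ v + 1 < a := by omega
    have h3 : v + 1 ≠ a := by omega
    simp [tailProb, h1, h2, h3]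
  · simp [tailProb]
  · have h1 : v < a := by omega
    have h3 : v + 1 ≠ a := by omega
    simp only [tailProb, h1, ha, h3, if_true, if_false, mul_zero, zero_add]
    by_cases hex : ∃ c ∈ p.support, v + 1 < c
    · rw [mul_comm, resid_succ_mul h0 hex (by omega)]
      congr 3
      omega
    · push Not at hex
      -- the level `v + 1` is the last one, so that it is reached with certainty
      have hs : (resid p v).support ⊆ {1} := fun k hk => by
        obtain ⟨hk0, hk⟩ := (mem_support_resid h0 hv).1 hk
        have := hex _ hk
        exact Set.mem_singleton_iff.2 (by omega)
      have h1' : resid p v 1 = 1 := by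
        rw [PMF.apply_eq_one_iff]
        exact (Set.Nonempty.subset_singleton_iff (resid p v).support_nonempty).1 hs
      have hz : resid p v (a - v) = 0 := by
        by_contra hne
        have := Set.mem_singleton_iff.1 (hs hne)
        omega
      simp [h1', hz]

theorem deviation_start (h0 : p 0 = 0) (a : ℕ) : deviation p a (0, []) = 0 := by
  simp [deviation, tailProb_zero h0]

theorem deviation_full (h0 : p 0 = 0) (a : ℕ) {l : List ℕ} :
    deviation p a (0, l) = l.count a - l.length * (p a).toReal := by
  rw [deviation, tailProb_zero h0]
  ring

/-- The deviation is a martingale with increments at most `1`. -/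
theorem deviation_sq_step (h0 : p 0 = 0) {v : ℕ} (hv : ∃ c ∈ p.support, v < c) (l : List ℕ)
    (a : ℕ) :
    (resid p v 1).toReal * deviation p a (0, (v + 1) :: l) ^ 2 +
      (1 - (resid p v 1).toReal) * deviation p a (v + 1, l) ^ 2 ≤ deviation p a (v, l) ^ 2 + 1 := by
  have htot := tailProb_eq h0 hv a
  obtain ⟨g0, g1⟩ := tailProb_mem p a v
  obtain ⟨g0', g1'⟩ := tailProb_mem p a (v + 1)
  have hh0 : 0 ≤ (resid p v 1).toReal := ENNReal.toReal_nonneg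
  have hh1 := toReal_apply_le_one (resid p v) 1
  set h := (resid p v 1).toReal
  set x := deviation p a (v, l) with hx
  obtain ⟨d, hd, hd0, hd1⟩ : ∃ d : ℝ, d = (if v + 1 = a then 1 else 0) ∧ 0 ≤ d ∧ d ≤ 1 := by
    refine ⟨_, rfl, ?_⟩
    split_ifs <;> norm_num
  have e1 : deviation p a (0, (v + 1) :: l) = x + (d - tailProb p a v) := by
    rw [hx, hd]
    simp only [deviation, tailProb_zero h0, List.count_cons, List.length_cons, beq_iff_eq]
    push_cast
    ring
  have e2 : deviation p a (v + 1, l) = x + (tailProb p a (v + 1) - tailProb p a v) := by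
    rw [hx]
    simp only [deviation]
    ring
  rw [e1, e2]
  rw [← hd] at htot
  set g := tailProb p a v
  set g' := tailProb p a (v + 1)
  have s1 : (d - g) ^ 2 ≤ 1 := by
    rw [sq_le_one_iff_abs_le_one, abs_le]
    constructor <;> linarith
  have s2 : (g' - g) ^ 2 ≤ 1 := by
    rw [sq_le_one_iff_abs_le_one, abs_le]
    constructor <;> linarith
  have key : h * (x + (d - g)) ^ 2 + (1 - h) * (x + (g' - g)) ^ 2 =
      x ^ 2 + 2 * x * (h * d + (1 - h) * g' - g) + (h * (d - g) ^ 2 + (1 - h) * (g' - g) ^ 2) := by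
    ring
  rw [key, htot, sub_self, mul_zero, add_zero]
  have t1 := mul_le_mul_of_nonneg_left s1 hh0
  have t2 := mul_le_mul_of_nonneg_left s2 (sub_nonneg.2 hh1)
  linarith

/-- Potential of a sampler with `N` samples below `K`: the sum of the squared deviations of all
values, and a reserve for the observations that the sampler is still going to use. -/
noncomputable def potential (p : PMF ℕ) (S : Finset ℕ) (N K : ℕ) (q : Sampler) : ℝ :=
  ∑ a ∈ S, deviation p a q ^ 2 + S.card * (N * K - q.used)

theorem potential_start (h0 : p 0 = 0) (S : Finset ℕ) :
    potential p S N K (0, []) = S.card * (N * K) := by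
  simp [potential, deviation_start h0, Sampler.used]

theorem used_le {S : Set ℕ} (hq : q.OK N S) (hS : ∀ c ∈ S, c ≤ K) : q.used ≤ N * K := by
  obtain ⟨⟨c, hc, hlt⟩, hs, hl, hN⟩ := hq
  have h1 : q.2.sum ≤ q.2.length * K := by
    have := List.sum_le_card_nsmul q.2 K fun x hx => hS x (hs x hx)
    simpa using this
  have h2 := hS c hc
  unfold Sampler.used
  rcases hl.lt_or_eq with hl | hl
  · have : (q.2.length + 1) * K ≤ N * K := Nat.mul_le_mul_right K hl
    rw [add_mul] at this
    omega
  · have := hN hl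
    rw [hl] at h1
    omega

theorem sq_deviation_le_potential {S : Finset ℕ} (hq : q.OK N S) (hS : ∀ c ∈ S, c ≤ K) {a : ℕ}
    (ha : a ∈ S) : deviation p a q ^ 2 ≤ potential p S N K q := by
  have h1 : (q.used : ℝ) ≤ N * K := by exact_mod_cast used_le hq fun c hc => hS c hc
  have h2 := Finset.single_le_sum (f := fun a => deviation p a q ^ 2)
    (fun a _ => sq_nonneg _) ha
  have h3 : 0 ≤ (S.card : ℝ) * (N * K - q.used) :=
    mul_nonneg (Nat.cast_nonneg _) (sub_nonneg.2 h1)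
  unfold potential
  linarith

theorem potential_nonneg {S : Finset ℕ} (hq : q.OK N S) (hS : ∀ c ∈ S, c ≤ K) :
    0 ≤ potential p S N K q := by
  obtain ⟨⟨c, hc, -⟩, -⟩ := id hq
  exact (sq_nonneg _).trans (sq_deviation_le_potential hq hS hc)

/-- The potential is a supermartingale: `h` is the probability of success. -/
theorem potential_step (h0 : p 0 = 0) {S : Finset ℕ} (hq : ∃ c ∈ p.support, q.1 < c)
    {run : Bool} {level : ℕ} {h : ℝ}
    (hh : run = true → level = q.1 → h = (resid p level 1).toReal) :
    h * potential p S N K (Algo.sample N run level true q) +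
      (1 - h) * potential p S N K (Algo.sample N run level false q) ≤ potential p S N K q := by
  by_cases ht : run = true ∧ level = q.1 ∧ q.2.length < N
  · obtain ⟨rfl, hl, hN⟩ := ht
    have e := hh rfl hl
    have hsum := Finset.sum_le_sum fun a (_ : a ∈ S) => deviation_sq_step h0 hq q.2 a
    simp only [Finset.sum_add_distrib, ← Finset.mul_sum, Finset.sum_const, nsmul_eq_mul,
      mul_one] at hsum
    rw [← hl, ← e, hl] at hsum
    unfold potential
    rw [Algo.used_sample hl hN, Algo.used_sample hl hN, Algo.sample_true hl hN,
      Algo.sample_false hl hN]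
    push_cast
    linarith
  · rw [Algo.sample_of_not ht, Algo.sample_of_not ht]
    exact le_of_eq (by ring)

end Sampler

namespace TaskSystem

variable {n : ℕ} {Υ : TaskSystem n} {N t : ℕ} {Z Z' : Fin n → Algo.Memo} {ε γ : ℚ}

/-- The sum of the potentials of all samplers. -/
noncomputable def totalPotential (Υ : TaskSystem n) (N : ℕ) (Z : Fin n → Algo.Memo) : ℝ :=
  ∑ i, (potential (Υ.task i).comp (Υ.task i).comp_finite.toFinset N
      (Algo.bound Υ.structCode) (Z i).2.1 +
    potential (Υ.task i).arr (Υ.task i).arr_finite.toFinset N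
      (Algo.bound Υ.structCode) (Z i).2.2)

theorem Reach.comp_ok (h : Υ.Reach N t Z) (i : Fin n) :
    (Z i).2.1.OK N ((Υ.task i).comp_finite.toFinset : Set ℕ) := by
  rw [Set.Finite.coe_toFinset]
  exact (h.memoOK i).comp

theorem Reach.arr_ok (h : Υ.Reach N t Z) (i : Fin n) :
    (Z i).2.2.OK N ((Υ.task i).arr_finite.toFinset : Set ℕ) := by
  rw [Set.Finite.coe_toFinset]
  exact (h.memoOK i).arr

theorem comp_le_bound {i : Fin n} (c : ℕ) (hc : c ∈ (Υ.task i).comp_finite.toFinset) :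
    c ≤ Algo.bound Υ.structCode := (comp_lt_bound (by simpa using hc)).le

theorem arr_le_bound {i : Fin n} (c : ℕ) (hc : c ∈ (Υ.task i).arr_finite.toFinset) :
    c ≤ Algo.bound Υ.structCode := (arr_lt_bound (by simpa using hc)).le

theorem card_comp_le (i : Fin n) :
    (Υ.task i).comp_finite.toFinset.card ≤ Algo.bound Υ.structCode := by
  rw [← Finset.card_range (Algo.bound Υ.structCode)]
  exact Finset.card_le_card fun c hc =>
    Finset.mem_range.2 (comp_lt_bound (by simpa using hc))

theorem card_arr_le (i : Fin n) :
    (Υ.task i).arr_finite.toFinset.card ≤ Algo.bound Υ.structCode := by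
  rw [← Finset.card_range (Algo.bound Υ.structCode)]
  exact Finset.card_le_card fun c hc =>
    Finset.mem_range.2 (arr_lt_bound (by simpa using hc))

theorem Reach.potentials_nonneg (h : Υ.Reach N t Z) (i : Fin n) :
    0 ≤ potential (Υ.task i).comp (Υ.task i).comp_finite.toFinset N
      (Algo.bound Υ.structCode) (Z i).2.1 ∧
    0 ≤ potential (Υ.task i).arr (Υ.task i).arr_finite.toFinset N
      (Algo.bound Υ.structCode) (Z i).2.2 :=
  ⟨potential_nonneg (h.comp_ok i) comp_le_bound, potential_nonneg (h.arr_ok i) arr_le_bound⟩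

theorem Reach.totalPotential_nonneg (h : Υ.Reach N t Z) : 0 ≤ Υ.totalPotential N Z :=
  Finset.sum_nonneg fun i _ => add_nonneg (h.potentials_nonneg i).1 (h.potentials_nonneg i).2

theorem totalPotential_start_le :
    Υ.totalPotential N (fun _ => Algo.start) ≤
      2 * n * (Algo.bound Υ.structCode) ^ 2 * N := by
  set K := Algo.bound Υ.structCode with hK
  have hK0 : (0 : ℝ) ≤ N * K := by positivity
  have : ∀ i ∈ Finset.univ, (potential (Υ.task i).comp (Υ.task i).comp_finite.toFinset N K
      Algo.start.2.1 + potential (Υ.task i).arr (Υ.task i).arr_finite.toFinset N K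
      Algo.start.2.2) ≤ 2 * (K : ℝ) ^ 2 * N := fun i _ => by
    have h1 : ((Υ.task i).comp_finite.toFinset.card : ℝ) ≤ K := by exact_mod_cast card_comp_le i
    have h2 : ((Υ.task i).arr_finite.toFinset.card : ℝ) ≤ K := by exact_mod_cast card_arr_le i
    have h3 := mul_le_mul_of_nonneg_right h1 hK0
    have h4 := mul_le_mul_of_nonneg_right h2 hK0
    simp only [Algo.start]
    rw [potential_start (Υ.task i).comp_zero, potential_start (Υ.task i).arr_zero]
    linarith
  refine (Finset.sum_le_sum this).trans_eq ?_
  simp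
  ring

/-- The total potential does not increase in the mean. -/
theorem Reach.sum_totalPotential_le (h : Υ.Reach N t Z) {act : Option (Fin n)}
    (ha : Υ.Good (phases Z) act) :
    ∑ m, (genMove (tick (Υ.conc (phases Z)) act) m).toReal *
      Υ.totalPotential N (nextMemo N Z act m) ≤ Υ.totalPotential N Z := by
  unfold totalPotential
  simp only [Finset.mul_sum, mul_add]
  rw [Finset.sum_comm]
  refine Finset.sum_le_sum fun i _ => ?_
  rw [Finset.sum_add_distrib]
  have hok := h.memoOK i
  refine add_le_add ?_ ?_
  · refine (sum_genMove_fst _ i fun b => potential (Υ.task i).comp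
      (Υ.task i).comp_finite.toFinset N (Algo.bound Υ.structCode)
      (Algo.sample N (decide (act = some i)) (Z i).1.1 b (Z i).2.1)).trans_le ?_
    refine potential_step (Υ.task i).comp_zero hok.comp.1 fun hi hl => ?_
    rw [decide_eq_true_iff] at hi
    obtain ⟨hd, -⟩ := (active_iff i).1 (ha.actionOK i hi)
    simp only [tick, conc, Task.job, hi, hd, if_true, Bool.false_eq_true, if_false]
    rw [dec_apply_zero (resid_zero_right (Υ.task i).comp_zero (hl ▸ hok.comp.1))]
  · refine (sum_genMove_snd _ i fun b => potential (Υ.task i).arr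
      (Υ.task i).arr_finite.toFinset N (Algo.bound Υ.structCode)
      (Algo.sample N true (Z i).1.2.1 b (Z i).2.2)).trans_le ?_
    refine potential_step (Υ.task i).arr_zero hok.arr.1 fun _ _ => ?_
    simp only [tick, conc, Task.job]
    rw [dec_apply_zero (resid_zero_right (Υ.task i).arr_zero hok.valid.2)]

theorem Reach.expect_kernel_le (hs : Υ.Schedulable) (h : Υ.Reach N t Z) :
    (expect (Υ.kernel N Z) fun Z' => ENNReal.ofReal (Υ.totalPotential N Z')) ≤
      ENNReal.ofReal (Υ.totalPotential N Z) := by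
  rw [kernel, expect_bind, ← expect_const (drawFrom (Υ.replies Z))
    (ENNReal.ofReal (Υ.totalPotential N Z))]
  refine expect_mono fun r hr => ?_
  obtain ⟨act, rfl, ha⟩ := (h.mem_support_drawFrom hs).1 hr
  rw [effective_conc h.valid ha.actionOK, expect_map]
  refine le_trans (le_of_eq ?_) (ENNReal.ofReal_le_ofReal (h.sum_totalPotential_le ha))
  unfold expect
  rw [tsum_fintype, ENNReal.ofReal_sum_of_nonneg fun m _ => ?_]
  · refine Finset.sum_congr rfl fun m _ => ?_
    rw [ENNReal.ofReal_mul ENNReal.toReal_nonneg, ENNReal.ofReal_toReal (PMF.apply_ne_top _ m)]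
  · by_cases hm : genMove (tick (Υ.conc (phases Z)) act) m = 0
    · simp [hm]
    · have hm' := (mem_support_iff_moveOK h.valid ha.actionOK).1 hm
      exact mul_nonneg ENNReal.toReal_nonneg (h.succ ha hm').totalPotential_nonneg

theorem expect_run_totalPotential_le (hs : Υ.Schedulable) :
    (expect (Υ.run Algo.learner ε γ t) fun h =>
      ENNReal.ofReal (Υ.totalPotential (Υ.size ε γ) (memoryOf (Υ.size ε γ) h))) ≤
      ENNReal.ofReal (2 * n * (Algo.bound Υ.structCode) ^ 2 * Υ.size ε γ) := by
  induction t with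
  | zero =>
    rw [run, expect_pure]
    exact ENNReal.ofReal_le_ofReal totalPotential_start_le
  | succ t ih =>
    rw [expect_run_succ hs fun Z => ENNReal.ofReal (Υ.totalPotential (Υ.size ε γ) Z)]
    exact (expect_mono fun h hh => (run_spec hs hh).1.expect_kernel_le hs).trans ih

/-- The empirical frequencies are close to the probabilities. -/
def Accurate (Υ : TaskSystem n) (δ : ℝ) (N : ℕ) (Z : Fin n → Algo.Memo) : Prop :=
  ∀ i, (∀ a ∈ (Υ.task i).comp.support,
      |((Z i).2.1.2.count a : ℝ) - N * ((Υ.task i).comp a).toReal| ≤ δ * N) ∧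
    ∀ a ∈ (Υ.task i).arr.support,
      |((Z i).2.2.2.count a : ℝ) - N * ((Υ.task i).arr a).toReal| ≤ δ * N

/-- If a sampler is full, its deviation is that of the empirical frequencies. -/
theorem abs_le_of_potential_le {p : PMF ℕ} (h0 : p 0 = 0) {S : Finset ℕ} {K : ℕ} {q : Sampler}
    (hq : q.OK N S) (hS : ∀ c ∈ S, c ≤ K) (hN : N ≤ q.2.length) {c : ℝ} (hc : 0 ≤ c)
    (hp : potential p S N K q ≤ c ^ 2) {a : ℕ} (ha : a ∈ S) :
    |(q.2.count a : ℝ) - N * (p a).toReal| ≤ c := by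
  have hl : q.2.length = N := le_antisymm hq.2.2.1 hN
  have h1 := (sq_deviation_le_potential hq hS ha).trans hp
  have h2 : deviation p a q = q.2.count a - N * (p a).toReal := by
    rw [← hl, ← deviation_full h0, ← hq.2.2.2 hl]
  rw [h2] at h1
  exact abs_le_of_sq_le_sq h1 hc

theorem Reach.lt_totalPotential (h : Υ.Reach N t Z) (hf : Full N Z) {δ : ℝ} (hδ : 0 ≤ δ)
    (hacc : ¬ Υ.Accurate δ N Z) : (δ * N) ^ 2 < Υ.totalPotential N Z := by
  by_contra hle
  push Not at hle
  have hnn := h.potentials_nonneg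
  have hc : 0 ≤ δ * N := by positivity
  refine hacc fun i => ?_
  have hi := (Finset.single_le_sum (fun i _ => add_nonneg (hnn i).1 (hnn i).2)
    (Finset.mem_univ i)).trans hle
  refine ⟨fun a ha => ?_, fun a ha => ?_⟩
  · exact abs_le_of_potential_le (Υ.task i).comp_zero (h.comp_ok i) comp_le_bound (hf i).1 hc
      ((le_add_of_nonneg_right (hnn i).2).trans hi) (by simpa using ha)
  · exact abs_le_of_potential_le (Υ.task i).arr_zero (h.arr_ok i) arr_le_bound (hf i).2 hc
      ((le_add_of_nonneg_left (hnn i).1).trans hi) (by simpa using ha)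

theorem size_eq : (Υ.size ε γ : ℝ) =
    8 * ((n + 1) * ((Algo.bound Υ.structCode : ℝ) * Algo.bound Υ.structCode) *
      ((ε.den : ℝ) * ε.den) * γ.den) := by
  have hl : Υ.structCode.length = n := by rw [structCode_eq, List.length_ofFn]
  unfold size Algo.sampleSize
  rw [hl]
  push_cast
  ring

theorem one_le_mul_den {r : ℚ} (hr : 0 < r) : 1 ≤ (r : ℝ) * r.den := by
  have h : (r * r.den : ℚ) = r.num := Rat.mul_den_eq_num r
  have h1 : 1 ≤ r.num := Rat.num_pos.2 hr
  have h2 : (1 : ℚ) ≤ r * r.den := by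
    rw [h]
    exact_mod_cast h1
  exact_mod_cast h2

theorem one_le_bound : (1 : ℝ) ≤ Algo.bound Υ.structCode := by
  exact_mod_cast Algo.bound_pos Υ.structCode

theorem size_pos : 0 < Υ.size ε γ := by
  have h1 := one_le_bound (Υ := Υ)
  have h2 : (0 : ℝ) < ε.den := by exact_mod_cast ε.den_pos
  have h3 : (0 : ℝ) < γ.den := by exact_mod_cast γ.den_pos
  have : (0 : ℝ) < Υ.size ε γ := by
    rw [size_eq]
    positivity
  exact_mod_cast this

/-- The probability that the learner is ready with inaccurate frequencies is at most `γ`. -/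
theorem toOuterMeasure_not_accurate_le (hs : Υ.Schedulable) (hε : 0 < ε) (hγ : 0 < γ) :
    (Υ.run Algo.learner ε γ t).toOuterMeasure
      {h | Full (Υ.size ε γ) (memoryOf (Υ.size ε γ) h) ∧
        ¬ Υ.Accurate (ε / 2) (Υ.size ε γ) (memoryOf (Υ.size ε γ) h)} ≤
      ENNReal.ofReal γ := by
  have hε' : (0 : ℝ) < ε := by exact_mod_cast hε
  have hγ' : (0 : ℝ) < γ := by exact_mod_cast hγ
  have hN : (0 : ℝ) < Υ.size ε γ := by exact_mod_cast size_pos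
  set N := Υ.size ε γ with hNdef
  have hc : 0 < ((ε : ℝ) / 2 * N) ^ 2 := by positivity
  have h := (toOuterMeasure_mul_le (p := Υ.run Algo.learner ε γ t)
    (g := fun h => ENNReal.ofReal (Υ.totalPotential N (memoryOf N h)))
    (s := {h | Full N (memoryOf N h) ∧ ¬ Υ.Accurate (ε / 2) N (memoryOf N h)})
    (c := ENNReal.ofReal (((ε : ℝ) / 2 * N) ^ 2)) fun h hh hb => ENNReal.ofReal_le_ofReal
      ((run_spec hs hh).1.lt_totalPotential hb.1 (by positivity) hb.2).le).trans
    (expect_run_totalPotential_le hs)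
  have hnum : 2 * n * (Algo.bound Υ.structCode : ℝ) ^ 2 * N ≤ γ * ((ε : ℝ) / 2 * N) ^ 2 := by
    have h1 := one_le_mul_den hε
    have h2 := one_le_mul_den hγ
    have h3 : (1 : ℝ) ≤ (ε * ε.den) * (ε * ε.den) * (γ * γ.den) := by
      have := one_le_mul_of_one_le_of_one_le h1 h1
      exact one_le_mul_of_one_le_of_one_le this h2
    have h4 : 2 * n * (Algo.bound Υ.structCode : ℝ) ^ 2 ≤ γ * (ε / 2) ^ 2 * N := by
      rw [hNdef, size_eq]
      set K := (Algo.bound Υ.structCode : ℝ)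
      have h5 : 2 * n * K ^ 2 ≤ 2 * (n + 1) * K ^ 2 := by
        gcongr
        linarith
      have h6 : 2 * (n + 1) * K ^ 2 * 1 ≤ 2 * (n + 1) * K ^ 2 *
          ((ε * ε.den) * (ε * ε.den) * (γ * γ.den)) := by
        gcongr
      refine h5.trans ((by linarith : _ ≤ 2 * (n + 1) * K ^ 2 *
          ((ε * ε.den) * (ε * ε.den) * (γ * γ.den))).trans_eq ?_)
      ring
    calc 2 * n * (Algo.bound Υ.structCode : ℝ) ^ 2 * N ≤ γ * (ε / 2) ^ 2 * N * N := by gcongr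
      _ = γ * ((ε : ℝ) / 2 * N) ^ 2 := by ring
  have h' := h.trans (ENNReal.ofReal_le_ofReal hnum)
  rw [ENNReal.ofReal_mul hγ'.le] at h'
  exact (ENNReal.mul_le_mul_iff_left (ENNReal.ofReal_pos.2 hc).ne' ENNReal.ofReal_ne_top).1 h'

/-! ### The learnt model -/

theorem ofMultiset_coe_apply {l : List ℕ} (hl : (l : Multiset ℕ) ≠ 0) (a : ℕ) :
    PMF.ofMultiset l hl a = (l.count a : ℝ≥0∞) / l.length := by
  rw [PMF.ofMultiset_apply, Multiset.coe_card, ← Multiset.coe_count]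
  congr!

theorem describes_ofMultiset {l : List ℕ} (hl : (l : Multiset ℕ) ≠ 0) :
    DistCode.Describes (l.map fun a => (a, 1)) (PMF.ofMultiset l hl) := by
  intro a
  have h1 : ∀ l : List ℕ, (((l.map fun a => (a, 1)).filter fun x => x.1 = a).map Prod.snd).sum =
      l.count a := fun l => by
    induction l with
    | nil => rfl
    | cons b l ih =>
      rw [List.map_cons, List.filter_cons, List.count_cons, ← ih]
      by_cases hb : b = a
      · simp [hb, add_comm]
      · simp [hb]
  have h2 : ((l.map fun a => (a, 1)).map Prod.snd).sum = l.length := by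
    simp [Function.comp_def]
  rw [h1, h2, ofMultiset_coe_apply]

theorem mem_support_ofMultiset_append {l l' : List ℕ} (hl : ((l ++ l' : List ℕ) : Multiset ℕ) ≠ 0)
    {p : PMF ℕ} (h1 : ∀ a, a ∈ l ↔ a ∈ p.support) (h2 : ∀ a ∈ l', a ∈ p.support) :
    (PMF.ofMultiset _ hl).support = p.support := by
  ext a
  have h : a ∈ (PMF.ofMultiset _ hl).support ↔ a ∈ l ++ l' := by
    rw [PMF.mem_support_ofMultiset_iff]
    simp
  rw [h, List.mem_append, h1]
  exact ⟨fun h => h.elim id (h2 a), Or.inl⟩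

/-- Counting every possible value once more changes the empirical frequencies by little. -/
theorem closeDist_ofMultiset {l l' : List ℕ} (hl : ((l ++ l' : List ℕ) : Multiset ℕ) ≠ 0)
    {p : PMF ℕ} (h1 : ∀ a, a ∈ l ↔ a ∈ p.support) (h2 : ∀ a ∈ l', a ∈ p.support)
    (hnd : l.Nodup) {δ : ℝ} (hN : 0 < l'.length) (hδ : (l.length : ℝ) ≤ δ / 2 * l'.length)
    (hacc : ∀ a ∈ p.support, |(l'.count a : ℝ) - l'.length * (p a).toReal| ≤ δ / 2 * l'.length) :
    CloseDist δ (PMF.ofMultiset _ hl) p := by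
  have hsupp := mem_support_ofMultiset_append hl h1 h2
  refine ⟨hsupp, fun a ha => ?_⟩
  rw [hsupp] at ha
  have hc : l.count a = 1 := List.count_eq_one_of_mem hnd ((h1 a).2 ha)
  have hS : (1 : ℝ) ≤ l.length := by
    exact_mod_cast List.length_pos_of_mem ((h1 a).2 ha)
  have hN' : (0 : ℝ) < l'.length := by exact_mod_cast hN
  have hp0 : 0 ≤ (p a).toReal := ENNReal.toReal_nonneg
  have hp1 := toReal_apply_le_one p a
  have hval : (PMF.ofMultiset _ hl a).toReal =
      (1 + l'.count a : ℝ) / (l.length + l'.length) := by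
    rw [ofMultiset_coe_apply, List.count_append, hc,
      List.length_append, ENNReal.toReal_div, ENNReal.toReal_natCast, ENNReal.toReal_natCast]
    push_cast
    rfl
  have h := abs_le.1 (hacc a ha)
  have hden : (0 : ℝ) < l.length + l'.length := by linarith
  have hSp := mul_le_mul_of_nonneg_left hp1 (zero_le_one.trans hS)
  have hSp0 := mul_nonneg (zero_le_one.trans hS) hp0
  have hδ0 : 0 ≤ δ := by
    by_contra hneg
    have := mul_neg_of_neg_of_pos (by linarith : δ / 2 < 0) hN'
    linarith
  have hδS := mul_nonneg hδ0 (zero_le_one.trans hS)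
  rw [hval, abs_le]
  constructor
  · rw [le_sub_comm, sub_neg_eq_add, ← sub_le_iff_le_add, le_div_iff₀ hden]
    linarith
  · rw [sub_le_iff_le_add, div_le_iff₀ hden]
    linarith

/-- If the empirical frequencies are accurate, the learnt model is close to the system. -/
theorem Reach.exists_close (h : Υ.Reach N t Z) (hf : Full N Z) (hN : 0 < N) {δ : ℝ}
    (hδ : (Algo.bound Υ.structCode : ℝ) ≤ δ / 2 * N) (hacc : Υ.Accurate (δ / 2) N Z) :
    ∃ ΥM : TaskSystem n, ModelCode.Describes (Υ.modelOf Z) ΥM ∧ ΥM.Close δ Υ := by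
  have hcl : ∀ i, (Z i).2.1.2.length = N := fun i =>
    le_antisymm (h.memoOK i).comp.2.2.1 (hf i).1
  have hal : ∀ i, (Z i).2.2.2.length = N := fun i =>
    le_antisymm (h.memoOK i).arr.2.2.1 (hf i).2
  have hc0 : ∀ i, (((Υ.entry i).2.1 ++ (Z i).2.1.2 : List ℕ) : Multiset ℕ) ≠ 0 := fun i h0 => by
    have := congrArg Multiset.card h0
    simp [hcl] at this
    omega
  have ha0 : ∀ i, (((Υ.entry i).2.2.2 ++ (Z i).2.2.2 : List ℕ) : Multiset ℕ) ≠ 0 := fun i h0 => by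
    have := congrArg Multiset.card h0
    simp [hal] at this
    omega
  have hcs := fun i => mem_support_ofMultiset_append (hc0 i) (fun a => Υ.mem_entry_comp)
    (h.memoOK i).comp.2.1
  have has := fun i => mem_support_ofMultiset_append (ha0 i) (fun a => Υ.mem_entry_arr)
    (h.memoOK i).arr.2.1
  have hcc : ∀ i, CloseDist δ (PMF.ofMultiset _ (hc0 i)) (Υ.task i).comp := fun i => by
    refine closeDist_ofMultiset (hc0 i) (fun a => Υ.mem_entry_comp) (h.memoOK i).comp.2.1
      (Finset.sort_nodup _ _) (by rw [hcl]; exact hN) ?_ ?_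
    · rw [hcl]
      refine le_trans ?_ hδ
      have : (Υ.entry i).2.1.length = (Υ.task i).comp_finite.toFinset.card :=
        Finset.length_sort _
      rw [this]
      exact_mod_cast card_comp_le i
    · rw [hcl]
      exact (hacc i).1
  have hca : ∀ i, CloseDist δ (PMF.ofMultiset _ (ha0 i)) (Υ.task i).arr := fun i => by
    refine closeDist_ofMultiset (ha0 i) (fun a => Υ.mem_entry_arr) (h.memoOK i).arr.2.1
      (Finset.sort_nodup _ _) (by rw [hal]; exact hN) ?_ ?_
    · rw [hal]
      refine le_trans ?_ hδ
      have : (Υ.entry i).2.2.2.length = (Υ.task i).arr_finite.toFinset.card :=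
        Finset.length_sort _
      rw [this]
      exact_mod_cast card_arr_le i
    · rw [hal]
      exact (hacc i).2
  let ΥM : TaskSystem n :=
    { task := fun i =>
        { comp := PMF.ofMultiset _ (hc0 i)
          deadline := (Υ.task i).deadline
          arr := PMF.ofMultiset _ (ha0 i)
          comp_finite := (hcs i).symm ▸ (Υ.task i).comp_finite
          arr_finite := (has i).symm ▸ (Υ.task i).arr_finite
          comp_pos := (hcs i).symm ▸ (Υ.task i).comp_pos
          comp_le := (hcs i).symm ▸ (Υ.task i).comp_le
          le_arr := (has i).symm ▸ (Υ.task i).le_arr }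
      hard := Υ.hard }
  refine ⟨ΥM, ⟨_, rfl, fun i => ⟨rfl, ?_, rfl, ?_⟩⟩, rfl, fun i =>
    ⟨hcs i, rfl, has i, hca i, hcc i⟩⟩
  · exact describes_ofMultiset (hc0 i)
  · exact describes_ofMultiset (ha0 i)

theorem bound_le_mul_size (hε : 0 < ε) :
    (Algo.bound Υ.structCode : ℝ) ≤ (ε : ℝ) / 2 * Υ.size ε γ := by
  have h1 := one_le_mul_den hε
  have h2 := one_le_bound (Υ := Υ)
  have h3 : (1 : ℝ) ≤ ε.den := by exact_mod_cast ε.den_pos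
  have h4 : (1 : ℝ) ≤ γ.den := by exact_mod_cast γ.den_pos
  have h5 : (1 : ℝ) ≤ n + 1 := by linarith [(Nat.cast_nonneg n : (0 : ℝ) ≤ n)]
  rw [size_eq]
  set K := (Algo.bound Υ.structCode : ℝ)
  have h6 : 1 ≤ (n + 1 : ℝ) * K * (ε * ε.den) * ε.den * γ.den :=
    one_le_mul_of_one_le_of_one_le (one_le_mul_of_one_le_of_one_le
      (one_le_mul_of_one_le_of_one_le (one_le_mul_of_one_le_of_one_le h5 h2) h1) h3) h4
  have h7 := mul_le_mul_of_nonneg_left h6 (zero_le_one.trans h2)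
  calc K ≤ 4 * (K * ((n + 1 : ℝ) * K * (ε * ε.den) * ε.den * γ.den)) := by linarith
    _ = _ := by ring

theorem safelyPACLearnable :
    SafelyPACLearnable (fun _ => {Υ | Υ.Schedulable ∧ Υ.GoodForSampling}) := by
  refine ⟨Algo.learner, Algo.computable_learner, fun n Υ hΥ ε γ hε _ hγ _ => ?_⟩
  obtain ⟨hs, hg⟩ : Υ.Schedulable ∧ Υ.GoodForSampling := hΥ
  have hfull : ∀ t, (Υ.run Algo.learner ε γ t).toOuterMeasure
      {h | Full (Υ.size ε γ) (memoryOf (Υ.size ε γ) h)} =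
      Υ.probFull (Υ.size ε γ) t fun _ => Algo.start := toOuterMeasure_full hs
  refine ⟨fun t h hh => (run_spec hs hh).2.2, ?_, ?_⟩
  · rw [← iSup_probFull (N := Υ.size ε γ) hs hg]
    refine iSup_congr fun t => ?_
    rw [← hfull]
    congr 1
    ext h
    simp only [Set.mem_ofPred_eq, and_true, output_learner]
    split_ifs with hf <;> simp [hf]
  · -- the learner is ready with probability one, and then wrong with probability at most `γ`
    have hle : ∀ t, Υ.probFull (Υ.size ε γ) t (fun _ => Algo.start) ≤
        Υ.probOutput Algo.learner ε γ (fun M => ∃ ΥM : TaskSystem n,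
          ModelCode.Describes M ΥM ∧ ΥM.Close (ε : ℝ) Υ) + ENNReal.ofReal γ := fun t => by
      rw [← hfull]
      refine le_trans ?_ (add_le_add (le_iSup (fun t =>
        (Υ.run Algo.learner ε γ t).toOuterMeasure {h | ∃ M, Υ.output Algo.learner ε γ h = some M ∧
          ∃ ΥM : TaskSystem n, ModelCode.Describes M ΥM ∧ ΥM.Close (ε : ℝ) Υ}) t)
        (toOuterMeasure_not_accurate_le (t := t) hs hε hγ))
      refine le_trans ?_ (MeasureTheory.measure_union_le _ _)
      refine PMF.toOuterMeasure_mono _ fun h hh => ?_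
      obtain ⟨hf, hsupp⟩ := hh
      rw [Set.mem_ofPred_eq] at hf
      by_cases hacc : Υ.Accurate (ε / 2) (Υ.size ε γ) (memoryOf (Υ.size ε γ) h)
      · left
        refine ⟨_, by rw [output_learner, if_pos hf], ?_⟩
        exact (run_spec hs hsupp).1.exists_close hf size_pos (bound_le_mul_size hε) hacc
      · exact Or.inr ⟨hf, hacc⟩
    have h1 := iSup_le hle
    rw [iSup_probFull hs hg] at h1
    rw [ENNReal.ofReal_sub _ (by exact_mod_cast hγ.le), ENNReal.ofReal_one]
    exact tsub_le_iff_right.2 h1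

end TaskSystem

end TaskLearning

theorem mainTheorem3 :
    TaskLearning.SafelyPACLearnable
      (fun _ => {Υ | Υ.Schedulable ∧ Υ.GoodForSampling}) :=
  TaskLearning.TaskSystem.safelyPACLearnable
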